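/- For a matrix $A=(A_{ij})_{0\le i,j\le 2N-1}$ that is skew-symmetric, let $\mathrm{Pf}\,A=\frac1{2^N N!}\sum_{\sigma}\operatorname{sgn}(\sigma)\prod_{k=0}^{N-1}A_{\sigma(2k)\,\sigma(2k+1)}$ (sum over all permutations of $\{0,\dots,2N-1\}$; $\mathrm{Pf}=1$ for $N=0$). For a weight $\omega$ on $\mathbb R$ put $\mu_n=\int_{\mathbb R}x^n\omega(x)\,dx$. Consider the weights $$\omega^{(H)}(x)=e^{-x^2}\ (x\in\mathbb R),\qquad \omega^{(L)}(x)=x^{a+1}e^{-x}\ (x>0),$$ $$\omega^{(J)}(x)=x^{a+1}(1-x)^{b+1}\ (0<x<1),\qquad \omega^{(C)}(x)=(1+x^2)^{1-a}\ (x\in\mathbb R),$$ where $\omega^{(L)}$ and $\omega^{(J)}$ vanish outside the indicated sets and $a,b$ are real. Let $N\ge 0$ be an integer; $n\ge0$ denotes an integer. (1) (Hermite) All moments converge absolutely, $\mu^{(H)}_n=\frac{1+(-1)^n}{2}\Gamma\left(\frac{n+1}2\right)$, and $$\mathrm{Pf}\left[(j-i)\mu^{(H)}_{i+j-1}\right]_{i,j=0}^{2N-1}=2^{-N(N-1)}(\sqrt\pi)^N\prod_{i=0}^{N-1}\Gamma(2i+2).$$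 (2) (Laguerre) Let $a>-2$. All moments converge absolutely, $\mu^{(L)}_n=\Gamma(n+a+2)$, and $$\mathrm{Pf}\left[(j-i)\mu^{(L)}_{i+j-1}\right]_{i,j=0}^{2N-1}=\prod_{i=0}^{N-1}\Gamma(2i+2)\Gamma(2i+a+2).$$ Equivalently (Mehta–Wang), for every real $b>-1$, $$\mathrm{Pf}\left[(j-i)\Gamma(i+j+b)\right]_{i,j=0}^{2N-1}=\prod_{i=0}^{N-1}\Gamma(2i+2)\Gamma(2i+b+1).$$ (3) (Jacobi) Let $a,b>-2$. All moments converge absolutely, $\mu^{(J)}_n=\frac{\Gamma(n+a+2)\Gamma(b+2)}{\Gamma(n+a+b+4)}$, and if $a+b\notin\{-2,-3\}$ (so that all Gamma functions below are finite), then $$\mathrm{Pf}\left[(j-i)\mu^{(J)}_{i+j-1}\right]_{i,j=0}^{2N-1}=4^N\,\frac{\Gamma\left(N+\frac{a+b+2}{4}\right)}{\Gamma\left(\frac{a+b+2}4\right)}\prod_{i=0}^{N-1}\frac{\Gamma(a+2i+2)\Gamma(b+2i+2)\Gamma(2i+2)\Gamma(a+b+2i+2)}{\Gamma(a+b+4i+3)\Gamma(a+b+4i+4)}.$$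 (4) (Cauchy) Let $a>2N-\frac12$. For every $n<2a-3$ the $n$-th moment converges absolutely and $\mu^{(C)}_n=\frac{1+(-1)^n}{2}\,\frac{\Gamma\left(\frac{n+1}{2}\right)\Gamma\left(a-1-\frac{n+1}2\right)}{\Gamma(a-1)}$; this covers all moments occurring in the following Pfaffian, and $$\mathrm{Pf}\left[(j-i)\mu^{(C)}_{i+j-1}\right]_{i,j=0}^{2N-1}=\pi^N\,2^{2N^2-N(2a-4)}\,\frac{\Gamma\left(\frac{a+1}{2}\right)}{\Gamma\left(\frac{a+1}{2}-N\right)}\prod_{i=0}^{N-1}\frac{\Gamma(2i+2)\Gamma(2a-4i-2)\Gamma(2a-4i-3)}{\Gamma(2a-2i-1)\,\Gamma(a-2i-1)^2}.$$ In all the matrices the diagonal entries are $0$. -/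

import Mathlib

open Real MeasureTheory
open scoped BigOperators Nat

namespace CatalanHankel

noncomputable section

/-- The Pfaffian of a `2N × 2N` matrix (applied only to skew-symmetric ones):
`(1 / (2^N N!)) ∑_σ sgn(σ) ∏_{k<N} A (σ(2k)) (σ(2k+1))`, the sum being over all permutations of
`{0, …, 2N-1}`. -/
def pfaffian (N : ℕ) (A : Matrix (Fin (2 * N)) (Fin (2 * N)) ℝ) : ℝ :=
  ((2 : ℝ) ^ N * (N ! : ℝ))⁻¹ *
    ∑ σ : Equiv.Perm (Fin (2 * N)), ((Equiv.Perm.sign σ : ℤ) : ℝ) *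
      ∏ k : Fin N, A (σ ⟨2 * (k : ℕ), by omega⟩) (σ ⟨2 * (k : ℕ) + 1, by omega⟩)

/-- The `n`-th moment `∫_ℝ x^n ω(x) dx` of a weight `ω` on the real line. -/
def moment (ω : ℝ → ℝ) (n : ℕ) : ℝ := ∫ x : ℝ, x ^ n * ω x

/-- The integral defining the `n`-th moment of `ω` converges (absolutely) and has the value `m`. -/
def HasMoment (ω : ℝ → ℝ) (n : ℕ) (m : ℝ) : Prop :=
  Integrable (fun x : ℝ => x ^ n * ω x) ∧ moment ω n = m

/-- The matrix `[(j - i) μ_{i+j-1}]_{i,j=0}^{2N-1}`. The truncated subtraction `i + j - 1` differs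
from the integer one only for `i = j = 0`, where the factor `j - i` vanishes. -/
def catalanHankelMatrix (μ : ℕ → ℝ) (N : ℕ) : Matrix (Fin (2 * N)) (Fin (2 * N)) ℝ :=
  Matrix.of fun i j => (((j : ℕ) : ℝ) - ((i : ℕ) : ℝ)) * μ ((i : ℕ) + (j : ℕ) - 1)

/-- `Pf [(j - i) μ_{i+j-1}]_{i,j=0}^{2N-1}`. -/
def catalanHankelPf (μ : ℕ → ℝ) (N : ℕ) : ℝ := pfaffian N (catalanHankelMatrix μ N)

/-- The Hermite weight `e^{-x²}` on `ℝ`. -/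
def hermiteWeight (x : ℝ) : ℝ := Real.exp (-x ^ 2)

/-- The Laguerre weight `x^{a+1} e^{-x}` on `(0, ∞)`, zero elsewhere. -/
def laguerreWeight (a : ℝ) : ℝ → ℝ :=
  (Set.Ioi 0).indicator fun x => x ^ (a + 1) * Real.exp (-x)

/-- The Jacobi weight `x^{a+1} (1-x)^{b+1}` on `(0, 1)`, zero elsewhere. -/
def jacobiWeight (a b : ℝ) : ℝ → ℝ :=
  (Set.Ioo 0 1).indicator fun x => x ^ (a + 1) * (1 - x) ^ (b + 1)

/-- The Cauchy weight `(1+x²)^{1-a}` on `ℝ`. -/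
def cauchyWeight (a : ℝ) (x : ℝ) : ℝ := (1 + x ^ 2) ^ (1 - a)

end

end CatalanHankel

/-! The matrix is the Gram matrix of the monomials for the skew form `⟨f, g⟩ = ∫ (f g' - f' g) ω`.
If for each `K < N` a monic polynomial of degree `2K+1` is skew-orthogonal to `x^j` for all `j <
2K`, a unipotent change of basis makes the Pfaffian the product of the pivots `c K = ⟨x^(2K), p⟩`.
The even basis vectors may stay monomials: only the odd rows need to be cleared (`pfaffian_eq_prod`,
resting on `pfaffian_conj` and `pfaffian_succ`).

For the classical weights the moments are Gamma quotients, and the odd polynomials have explicit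
coefficients: `(-1)^(k-i) * choose k i` times a Pochhammer symbol and, for Jacobi and Cauchy, a
Gamma quotient. The prefactors are chosen so that multiplying by a matrix entry leaves a constant
times a polynomial in `i`. Orthogonality then says that a finite difference of order `k` kills
degree below `k`. The pivot is a top coefficient for Hermite and Laguerre; for Jacobi and Cauchy one
simple pole in `i` survives, and partial fractions evaluate it
(`sum_alternating_choose_mul_eval_div`).

For the even weights the odd moments vanish, so the same scheme runs on the block pairing odd with
even indices. What remains is Legendre duplication and telescoping of Gamma values. -/

namespace CatalanHankel

/-! ### Pfaffians: congruence, expansion and elimination. -/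

section PfaffianElimination

open Finset Equiv

theorem prod_fin_two_mul {M : Type*} [CommMonoid M] (N : ℕ) (g : Fin (2 * N) → M) :
    ∏ l, g l = ∏ k : Fin N, g ⟨2 * k, by omega⟩ * g ⟨2 * k + 1, by omega⟩ := by
  induction N with
  | zero => simp
  | succ N ih =>
    have h := ih fun l => g ⟨l, by omega⟩
    rw [Fin.prod_univ_castSucc (n := N)]
    change ∏ l : Fin (2 * N + 1 + 1), g l = _
    rw [Fin.prod_univ_castSucc, Fin.prod_univ_castSucc, mul_assoc]
    exact congrArg (· * _) h

/-- The Pfaffian as a sum of determinants over the choices of a pair of indices for each factor. -/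
theorem pfaffian_conj_eq_sum_det (N : ℕ) (A B : Matrix (Fin (2 * N)) (Fin (2 * N)) ℝ) :
    pfaffian N (B * A * B.transpose) = ((2 : ℝ) ^ N * (N ! : ℝ))⁻¹ *
      ∑ f : Fin N → Fin (2 * N) × Fin (2 * N), (∏ k, A (f k).1 (f k).2) *
        (B.submatrix id fun l : Fin (2 * N) =>
          if (l : ℕ) % 2 = 0 then (f ⟨l / 2, by omega⟩).1 else (f ⟨l / 2, by omega⟩).2).det := by
  have entry (x y : Fin (2 * N)) : (B * A * B.transpose) x y =
      ∑ p : Fin (2 * N) × Fin (2 * N), A p.1 p.2 * (B x p.1 * B y p.2) := by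
    simp only [Matrix.mul_apply, Matrix.transpose_apply, Fintype.sum_prod_type, sum_mul]
    rw [sum_comm]
    exact sum_congr rfl fun _ _ => sum_congr rfl fun _ _ => by ring
  unfold pfaffian
  congr 1
  simp only [entry, Finset.prod_univ_sum, Fintype.piFinset_univ, Matrix.det_apply', mul_sum]
  -- For a fixed choice `f` of index pairs, the signed sum over `σ` is the Leibniz formula for the
  -- matrix whose columns are the columns of `B` selected by `f`.
  rw [sum_comm]
  refine sum_congr rfl fun f _ => sum_congr rfl fun σ _ => ?_
  rw [prod_fin_two_mul, prod_mul_distrib]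
  have h1 (k : Fin N) : (2 * (k : ℕ) + 1) % 2 ≠ 0 := by omega
  have h2 (k : Fin N) : (2 * (k : ℕ) + 1) / 2 = k := by omega
  simp only [Matrix.submatrix_apply, id, Nat.mul_mod_right, if_true, h1, if_false, h2,
    Nat.mul_div_cancel_left _ (Nat.two_pos)]
  ring

/-- Selecting columns of `B` is multiplying `B` by the same selection from the identity, so `det B`
factors out of every summand; what is left is the expansion for `B = 1`. Skew-symmetry plays no
role. -/
theorem pfaffian_conj (N : ℕ) (A B : Matrix (Fin (2 * N)) (Fin (2 * N)) ℝ) :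
    pfaffian N (B * A * B.transpose) = B.det * pfaffian N A := by
  have h := pfaffian_conj_eq_sum_det N A 1
  rw [Matrix.one_mul, Matrix.transpose_one, Matrix.mul_one] at h
  rw [h, pfaffian_conj_eq_sum_det, mul_left_comm]
  congr 1
  rw [mul_sum]
  refine sum_congr rfl fun f _ => ?_
  rw [mul_left_comm, ← Matrix.det_mul]
  congr 2
  ext i j
  simp [Matrix.mul_apply, Matrix.one_apply]

/-- One summand of the Pfaffian. -/
def pfaffianTerm (N : ℕ) (A : Matrix (Fin (2 * N)) (Fin (2 * N)) ℝ) (σ : Perm (Fin (2 * N))) : ℝ :=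
  ((Perm.sign σ : ℤ) : ℝ) *
    ∏ k : Fin N, A (σ ⟨2 * (k : ℕ), by omega⟩) (σ ⟨2 * (k : ℕ) + 1, by omega⟩)

theorem pfaffianTerm_mul_swap_pair {N : ℕ} {A : Matrix (Fin (2 * N)) (Fin (2 * N)) ℝ}
    (hA : ∀ i j, A j i = -A i j) (a : Fin N) (σ : Perm (Fin (2 * N))) :
    pfaffianTerm N A (σ * swap ⟨2 * (a : ℕ), by omega⟩ ⟨2 * (a : ℕ) + 1, by omega⟩) =
      pfaffianTerm N A σ := by
  unfold pfaffianTerm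
  have hs : Perm.sign (swap (⟨2 * (a : ℕ), by omega⟩ : Fin (2 * N)) ⟨2 * (a : ℕ) + 1, by omega⟩)
      = -1 := Perm.sign_swap (by simp)
  rw [Perm.sign_mul, hs, ← mul_prod_erase _ _ (mem_univ a), ← mul_prod_erase _ _ (mem_univ a)]
  rw [prod_congr rfl (g := fun k : Fin N =>
    A (σ ⟨2 * (k : ℕ), by omega⟩) (σ ⟨2 * (k : ℕ) + 1, by omega⟩))]
  · simp only [Perm.mul_apply, swap_apply_left, swap_apply_right]
    rw [hA (σ ⟨2 * (a : ℕ), by omega⟩)]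
    push_cast
    ring
  · intro k hk
    have hk' : (k : ℕ) ≠ a := fun h => (mem_erase.1 hk).1 (Fin.ext h)
    rw [Perm.mul_apply, Perm.mul_apply, swap_apply_of_ne_of_ne, swap_apply_of_ne_of_ne] <;>
      simp only [ne_eq, Fin.mk.injEq] <;> omega

theorem pfaffianTerm_mul_swap_blocks {N : ℕ} (A : Matrix (Fin (2 * N)) (Fin (2 * N)) ℝ)
    (a b : Fin N) (σ : Perm (Fin (2 * N))) :
    pfaffianTerm N A (σ * (swap ⟨2 * (a : ℕ), by omega⟩ ⟨2 * (b : ℕ), by omega⟩ *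
      swap ⟨2 * (a : ℕ) + 1, by omega⟩ ⟨2 * (b : ℕ) + 1, by omega⟩)) = pfaffianTerm N A σ := by
  unfold pfaffianTerm
  congr 1
  · rcases eq_or_ne a b with rfl | h
    · simp
    · have h' : (a : ℕ) ≠ b := fun e => h (Fin.ext e)
      rw [Perm.sign_mul, Perm.sign_mul, Perm.sign_swap (by simpa using h'),
        Perm.sign_swap (by simpa using h')]
      simp
  · rw [← Equiv.prod_comp (swap a b)]
    refine prod_congr rfl fun k _ => ?_
    have h0 : (swap ⟨2 * (a : ℕ), by omega⟩ ⟨2 * (b : ℕ), by omega⟩ *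
        swap ⟨2 * (a : ℕ) + 1, by omega⟩ ⟨2 * (b : ℕ) + 1, by omega⟩ : Perm (Fin (2 * N)))
        ⟨2 * (swap a b k : Fin N), by omega⟩ = ⟨2 * (k : ℕ), by omega⟩ := by
      simp only [Perm.mul_apply, swap_apply_def, Fin.ext_iff, apply_ite Fin.val]
      grind
    have h1 : (swap ⟨2 * (a : ℕ), by omega⟩ ⟨2 * (b : ℕ), by omega⟩ *
        swap ⟨2 * (a : ℕ) + 1, by omega⟩ ⟨2 * (b : ℕ) + 1, by omega⟩ : Perm (Fin (2 * N)))
        ⟨2 * (swap a b k : Fin N) + 1, by omega⟩ = ⟨2 * (k : ℕ) + 1, by omega⟩ := by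
      simp only [Perm.mul_apply, swap_apply_def, Fin.ext_iff, apply_ite Fin.val]
      grind
    exact congrArg₂ (fun x y => A (σ x) (σ y)) h0 h1

/-- The symmetries of a summand, namely swaps inside a pair (the sign cancels against skew-symmetry)
and exchanges of two pairs (an even permutation), act transitively on positions. -/
theorem exists_perm_pfaffianTerm_mul {N : ℕ} {A : Matrix (Fin (2 * N)) (Fin (2 * N)) ℝ}
    (hA : ∀ i j, A j i = -A i j) (b : Fin N) (p : Fin (2 * N)) :
    ∃ τ : Perm (Fin (2 * N)), τ ⟨2 * (b : ℕ) + 1, by omega⟩ = p ∧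
      ∀ σ, pfaffianTerm N A (σ * τ) = pfaffianTerm N A σ := by
  have hp := p.2
  obtain ⟨a, ha⟩ : ∃ a : Fin N, a = (⟨p / 2, by omega⟩ : Fin N) := ⟨_, rfl⟩
  have ha' : (a : ℕ) = p / 2 := by rw [ha]
  rcases Nat.mod_two_eq_zero_or_one p with h | h
  · refine ⟨swap ⟨2 * (a : ℕ), by omega⟩ ⟨2 * (a : ℕ) + 1, by omega⟩ *
      (swap ⟨2 * (a : ℕ), by omega⟩ ⟨2 * (b : ℕ), by omega⟩ *
      swap ⟨2 * (a : ℕ) + 1, by omega⟩ ⟨2 * (b : ℕ) + 1, by omega⟩), ?_, fun σ => ?_⟩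
    · have hfix : swap (⟨2 * (a : ℕ), by omega⟩ : Fin (2 * N)) ⟨2 * (b : ℕ), by omega⟩
          ⟨2 * (a : ℕ) + 1, by omega⟩ = ⟨2 * (a : ℕ) + 1, by omega⟩ :=
        swap_apply_of_ne_of_ne (by simp) (by simp only [ne_eq, Fin.mk.injEq]; omega)
      rw [Perm.mul_apply, Perm.mul_apply, swap_apply_right, hfix, swap_apply_right]
      exact Fin.ext (by simp only; omega)
    · rw [← mul_assoc, pfaffianTerm_mul_swap_blocks, pfaffianTerm_mul_swap_pair hA]
  · refine ⟨swap ⟨2 * (a : ℕ), by omega⟩ ⟨2 * (b : ℕ), by omega⟩ *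
      swap ⟨2 * (a : ℕ) + 1, by omega⟩ ⟨2 * (b : ℕ) + 1, by omega⟩, ?_, fun σ => ?_⟩
    · rw [Perm.mul_apply, swap_apply_right, swap_apply_of_ne_of_ne]
      · exact Fin.ext (by simp only; omega)
      · simp
      · simp only [ne_eq, Fin.mk.injEq]; omega
    · rw [pfaffianTerm_mul_swap_blocks]

/-- The value `m` occurs at exactly one position `p` of each `σ`, and by transitivity all `2N`
positions contribute equally. -/
theorem sum_pfaffianTerm {N : ℕ} {A : Matrix (Fin (2 * N)) (Fin (2 * N)) ℝ}
    (hA : ∀ i j, A j i = -A i j) (b : Fin N) (m : Fin (2 * N)) (hm : (m : ℕ) = 2 * b + 1) :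
    ∑ σ, pfaffianTerm N A σ =
      2 * N * ∑ σ : Perm (Fin (2 * N)), if σ m = m then pfaffianTerm N A σ else 0 := by
  have hm' : m = ⟨2 * (b : ℕ) + 1, by omega⟩ := Fin.ext hm
  calc ∑ σ, pfaffianTerm N A σ
      = ∑ σ : Perm (Fin (2 * N)), ∑ p, if σ p = m then pfaffianTerm N A σ else 0 := by
        refine sum_congr rfl fun σ _ => ?_
        simp only [← Equiv.eq_symm_apply, sum_ite_eq', mem_univ, if_true]
    _ = ∑ p : Fin (2 * N), ∑ σ : Perm (Fin (2 * N)),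
          if σ m = m then pfaffianTerm N A σ else 0 := by
        rw [sum_comm]
        refine sum_congr rfl fun p _ => ?_
        obtain ⟨τ, hτ, h⟩ := exists_perm_pfaffianTerm_mul hA b p
        rw [← hm'] at hτ
        rw [← Equiv.sum_comp (Equiv.mulRight τ) fun σ : Perm (Fin (2 * N)) =>
          if σ m = m then pfaffianTerm N A σ else 0]
        refine sum_congr rfl fun σ _ => ?_
        simp only [Equiv.coe_mulRight, h, Perm.mul_apply, hτ]
    _ = _ := by simp

/-- The set `{0, …, 2N-1}` as a subtype of `{0, …, 2N+1}`. -/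
def castSuccEquiv (N : ℕ) : Fin (2 * N) ≃ {x : Fin (2 * (N + 1)) // (x : ℕ) < 2 * N} where
  toFun x := ⟨⟨x, by omega⟩, x.2⟩
  invFun x := ⟨x.1, x.2⟩
  left_inv _ := rfl
  right_inv _ := rfl

theorem pfaffianTerm_extendDomain {N : ℕ} (A : ℕ → ℕ → ℝ) (ρ : Perm (Fin (2 * N))) :
    pfaffianTerm (N + 1) (Matrix.of fun i j => A i j) (ρ.extendDomain (castSuccEquiv N)) =
      pfaffianTerm N (Matrix.of fun i j => A i j) ρ * A (2 * N) (2 * N + 1) := by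
  unfold pfaffianTerm
  rw [Perm.sign_extendDomain, Fin.prod_univ_castSucc, mul_assoc]
  have key (l : ℕ) (hl : l < 2 * N) (hl') :
      ((ρ.extendDomain (castSuccEquiv N) ⟨l, hl'⟩ : Fin (2 * (N + 1))) : ℕ) = ρ ⟨l, hl⟩ :=
    congrArg Fin.val (Perm.extendDomain_apply_image ρ (castSuccEquiv N) ⟨l, hl⟩)
  have key' (l : ℕ) (hl : ¬ l < 2 * N) (hl') :
      ((ρ.extendDomain (castSuccEquiv N) ⟨l, hl'⟩ : Fin (2 * (N + 1))) : ℕ) = l :=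
    congrArg Fin.val (Perm.extendDomain_apply_not_subtype ρ (castSuccEquiv N) hl)
  congr 2
  · refine prod_congr rfl fun k _ => ?_
    simp only [Matrix.of_apply]
    rw [key _ (by have := k.2; simp), key _ (by have := k.2; simp; omega)]
    rfl
  · simp only [Matrix.of_apply, Fin.val_last]
    rw [key' _ (by omega), key' _ (by omega)]

/-- Expansion of the Pfaffian along a last row with a single nonzero entry. -/
theorem pfaffian_succ (N : ℕ) (A : ℕ → ℕ → ℝ) (hA : ∀ i j, A j i = -A i j)
    (h0 : ∀ j < 2 * N, A (2 * N + 1) j = 0) :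
    pfaffian (N + 1) (Matrix.of fun i j => A i j) =
      pfaffian N (Matrix.of fun i j => A i j) * A (2 * N) (2 * N + 1) := by
  have hsum : ∑ σ : Perm (Fin (2 * (N + 1))),
      (if σ ⟨2 * N + 1, by omega⟩ = ⟨2 * N + 1, by omega⟩ then
        pfaffianTerm (N + 1) (Matrix.of fun i j => A i j) σ else 0) =
      ∑ ρ, pfaffianTerm N (Matrix.of fun i j => A i j) ρ * A (2 * N) (2 * N + 1) := by
    symm
    refine sum_of_injOn (fun ρ => ρ.extendDomain (castSuccEquiv N))
      (fun ρ _ ρ' _ h => Perm.extendDomainHom_injective (castSuccEquiv N) h)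
      (fun _ _ => mem_coe.2 (mem_univ _)) (fun σ _ hσ => ?_) (fun ρ _ => ?_)
    · rw [ite_eq_right_iff]
      intro hm
      by_contra hne
      apply hσ
      -- A nonzero summand with `2N+1` fixed has nonzero last factor; the zeros of row `2N+1` then
      -- force `σ` to fix `2N` too, so `σ` extends a permutation of the first `2N` indices.
      have hfac : A (σ ⟨2 * N, by omega⟩) (σ ⟨2 * N + 1, by omega⟩) ≠ 0 := fun h =>
        hne (mul_eq_zero_of_right _ (prod_eq_zero (mem_univ (Fin.last N)) h))
      have hdiag : A (2 * N + 1) (2 * N + 1) = 0 := by linarith [hA (2 * N + 1) (2 * N + 1)]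
      have hm' : σ ⟨2 * N, by omega⟩ = ⟨2 * N, by omega⟩ := by
        rw [hm, hA (2 * N + 1), neg_ne_zero] at hfac
        have h1 := (σ ⟨2 * N, by omega⟩).2
        have h2 : ¬ ((σ ⟨2 * N, by omega⟩ : Fin (2 * (N + 1))) : ℕ) < 2 * N :=
          fun h => hfac (h0 _ h)
        have h3 : ((σ ⟨2 * N, by omega⟩ : Fin (2 * (N + 1))) : ℕ) ≠ 2 * N + 1 :=
          fun h => hfac (by rw [h]; exact hdiag)
        exact Fin.ext (by simp only; omega)
      have hfix (x : Fin (2 * (N + 1))) (hx : ¬ (x : ℕ) < 2 * N) : σ x = x := by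
        have := x.2
        rcases (show (x : ℕ) = 2 * N ∨ (x : ℕ) = 2 * N + 1 by omega) with h | h
        · rw [show x = ⟨2 * N, by omega⟩ from Fin.ext h, hm']
        · rw [show x = ⟨2 * N + 1, by omega⟩ from Fin.ext h, hm]
      have hinv (x : Fin (2 * (N + 1))) : (σ x : ℕ) < 2 * N ↔ (x : ℕ) < 2 * N := by
        constructor
        · intro h
          by_contra hx
          rw [hfix x hx] at h
          exact hx h
        · intro h
          by_contra hx
          rw [σ.injective (hfix _ hx)] at hx
          exact hx h
      refine ⟨(castSuccEquiv N).symm.permCongr (σ.subtypePerm hinv), mem_coe.2 (mem_univ _), ?_⟩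
      ext x
      by_cases hx : (x : ℕ) < 2 * N
      · have := Perm.extendDomain_apply_image
          ((castSuccEquiv N).symm.permCongr (σ.subtypePerm hinv)) (castSuccEquiv N) ⟨x, hx⟩
        simpa [castSuccEquiv] using congrArg Fin.val this
      · simp only
        rw [Perm.extendDomain_apply_not_subtype _ (castSuccEquiv N) hx, hfix x hx]
    · rw [if_pos, pfaffianTerm_extendDomain]
      exact Perm.extendDomain_apply_not_subtype ρ (castSuccEquiv N) (by simp)
  have := sum_pfaffianTerm (A := Matrix.of fun i j : Fin (2 * (N + 1)) => A i j)
    (fun i j => hA i j) (Fin.last N) ⟨2 * N + 1, by omega⟩ rfl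
  rw [hsum, ← sum_mul] at this
  change _ * ∑ σ, pfaffianTerm _ _ σ = (_ * ∑ σ, pfaffianTerm _ _ σ) * _
  rw [this, Nat.factorial_succ]
  have : (N ! : ℝ) ≠ 0 := by positivity
  push_cast
  field_simp
  ring

theorem pfaffian_eq_prod_of_odd_rows (N : ℕ) (A : ℕ → ℕ → ℝ) (hA : ∀ i j, A j i = -A i j)
    (h0 : ∀ K < N, ∀ j < 2 * K, A (2 * K + 1) j = 0) :
    pfaffian N (Matrix.of fun i j => A i j) = ∏ K ∈ range N, A (2 * K) (2 * K + 1) := by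
  induction N with
  | zero => simp [pfaffian]
  | succ N ih =>
    rw [pfaffian_succ N A hA (h0 N (by omega)), ih fun K hK => h0 K (by omega), prod_range_succ]

/-- If unipotent row operations on the odd rows of a skew-symmetric matrix kill the entries of row
`2K+1` to the left of column `2K`, the Pfaffian is the product of the pivots. -/
theorem pfaffian_eq_prod (N : ℕ) (A P : ℕ → ℕ → ℝ) (c : ℕ → ℝ) (hA : ∀ i j, A j i = -A i j)
    (hP : ∀ K < N, P K (2 * K + 1) = 1)
    (h0 : ∀ K < N, ∀ j < 2 * K, ∑ i ∈ range (2 * K + 2), P K i * A i j = 0)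
    (h1 : ∀ K < N, ∑ i ∈ range (2 * K + 2), P K i * A i (2 * K) = -c K) :
    pfaffian N (Matrix.of fun i j => A i j) = ∏ K ∈ range N, c K := by
  -- Even rows are those of the identity; row `2K+1` carries `P K` up to the diagonal, where it is
  -- `1`. Hence `B` is lower unitriangular.
  let B : ℕ → ℕ → ℝ := fun i k =>
    if i % 2 = 0 then (if k = i then 1 else 0) else if k ≤ i then P (i / 2) k else 0
  have hB (i k : ℕ) (h : i < k) : B i k = 0 := by
    simp only [B]
    split_ifs <;> first | rfl | omega
  let A' : ℕ → ℕ → ℝ := fun x y => ∑ l ∈ range (2 * N), ∑ k ∈ range (2 * N), B x k * A k l * B y l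
  have hconj : (Matrix.of fun i j : Fin (2 * N) => B i j) * (Matrix.of fun i j : Fin (2 * N) => A i j) *
      (Matrix.of fun i j : Fin (2 * N) => B i j).transpose =
      Matrix.of fun i j : Fin (2 * N) => A' i j := by
    ext x y
    simp only [Matrix.mul_apply, Matrix.of_apply, Matrix.transpose_apply, sum_mul, A', sum_range]
  have hdet : (Matrix.of fun i j : Fin (2 * N) => B i j).det = 1 := by
    rw [Matrix.det_of_isLowerTriangular]
    · refine prod_eq_one fun i _ => ?_
      simp only [Matrix.of_apply, B, if_true, le_refl]
      split_ifs with h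
      · rfl
      · have := hP (i / 2) (by omega)
        rwa [show 2 * ((i : ℕ) / 2) + 1 = i by omega] at this
    · intro i j hij
      exact hB _ _ hij
  have hA' (i j : ℕ) : A' j i = -A' i j := by
    simp only [A']
    rw [sum_comm, ← sum_neg_distrib]
    refine sum_congr rfl fun k _ => ?_
    rw [← sum_neg_distrib]
    refine sum_congr rfl fun l _ => ?_
    rw [hA l k]
    ring
  have hrow (K : ℕ) (hK : K < N) (l : ℕ) : ∑ k ∈ range (2 * N), B (2 * K + 1) k * A k l =
      ∑ k ∈ range (2 * K + 2), P K k * A k l := by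
    have hsub : range (2 * K + 2) ⊆ range (2 * N) := range_subset_range.2 (by omega)
    rw [← sum_subset hsub]
    · refine sum_congr rfl fun k hk => ?_
      have hk := mem_range.1 hk
      simp only [B]
      rw [if_neg (by omega), if_pos (by omega), show (2 * K + 1) / 2 = K by omega]
    · intro k _ hk
      rw [hB _ _ (by simp at hk; omega), zero_mul]
  have hrow' (K : ℕ) (hK : K < N) (j : ℕ) : A' (2 * K + 1) j =
      ∑ l ∈ range (2 * N), (∑ k ∈ range (2 * K + 2), P K k * A k l) * B j l := by
    simp only [A', ← hrow K hK, sum_mul]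
  have := pfaffian_conj N (Matrix.of fun i j => A i j) (Matrix.of fun i j : Fin (2 * N) => B i j)
  rw [hdet, one_mul, hconj] at this
  rw [← this, pfaffian_eq_prod_of_odd_rows N A' hA']
  · refine prod_congr rfl fun K hK => ?_
    have hK := mem_range.1 hK
    rw [hA' (2 * K + 1), hrow' K hK, sum_eq_single (2 * K)]
    · rw [h1 K hK]
      simp [B]
    · intro l _ hl
      simp only [B]
      rw [if_pos (by omega), if_neg hl, mul_zero]
    · intro h
      simp at h
      omega
  · intro K hK j hj
    rw [hrow' K hK]
    refine sum_eq_zero fun l _ => ?_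
    rcases lt_or_ge j l with h | h
    · rw [hB _ _ h, mul_zero]
    · rw [h0 K hK l (by omega), zero_mul]

/-- The version of `pfaffian_eq_prod` for matrices with a checkerboard pattern of zeros. -/
theorem pfaffian_eq_prod_of_checkerboard (N : ℕ) (A P : ℕ → ℕ → ℝ) (c : ℕ → ℝ)
    (hA : ∀ i j, A j i = -A i j) (hodd : ∀ I J, A (2 * I + 1) (2 * J + 1) = 0)
    (hP : ∀ K < N, P K K = 1)
    (h0 : ∀ K < N, ∀ J < K, ∑ I ∈ range (K + 1), P K I * A (2 * I + 1) (2 * J) = 0)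
    (h1 : ∀ K < N, ∑ I ∈ range (K + 1), P K I * A (2 * I + 1) (2 * K) = -c K) :
    pfaffian N (Matrix.of fun i j => A i j) = ∏ K ∈ range N, c K := by
  have hsum (K j : ℕ) : ∑ i ∈ range (2 * K + 2), (if i % 2 = 0 then 0 else P K (i / 2)) * A i j =
      ∑ I ∈ range (K + 1), P K I * A (2 * I + 1) j := by
    rw [show 2 * K + 2 = 2 * (K + 1) by ring]
    generalize P K = p
    induction K + 1 with
    | zero => simp
    | succ M ih =>
      rw [sum_range_succ, ← ih, show 2 * (M + 1) = 2 * M + 1 + 1 by ring, sum_range_succ,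
        sum_range_succ, if_pos (by omega), if_neg (by omega), zero_mul, add_zero,
        show (2 * M + 1) / 2 = M by omega]
  refine pfaffian_eq_prod N A (fun K i => if i % 2 = 0 then 0 else P K (i / 2)) c hA
    (fun K hK => ?_) (fun K hK j hj => ?_) (fun K hK => ?_)
  · rw [if_neg (by omega), show (2 * K + 1) / 2 = K by omega, hP K hK]
  · rw [hsum]
    rcases Nat.even_or_odd' j with ⟨J, rfl | rfl⟩
    · exact h0 K hK J (by omega)
    · exact sum_eq_zero fun I _ => by rw [hodd, mul_zero]
  · rw [hsum, h1 K hK]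

end PfaffianElimination

/-! ### Alternating binomial sums; the Laguerre and Jacobi Pfaffians. -/

section PochhammerSums

open Finset Polynomial

/-- The left side is the `K`-th forward difference of `Q` at `0`. -/
theorem sum_alternating_choose_mul_eval {K : ℕ} {Q : ℝ[X]} (hQ : Q.natDegree ≤ K) :
    ∑ I ∈ range (K + 1), (-1) ^ (K - I) * (K.choose I : ℝ) * Q.eval (I : ℝ) = K ! * Q.coeff K := by
  have key (f : ℝ → ℝ) : ∑ I ∈ range (K + 1), (-1) ^ (K - I) * (K.choose I : ℝ) * f I =
      (fwdDiff (1 : ℝ))^[K] f 0 := by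
    rw [fwdDiff_iter_eq_sum_shift]
    refine sum_congr rfl fun I _ => ?_
    simp
  rw [key Q.eval]
  rcases hQ.lt_or_eq with h | rfl
  · rw [show (fun x => eval x Q) = Q.eval from rfl, fwdDiff_iter_eq_zero_of_degree_lt h,
      coeff_eq_zero_of_natDegree_lt h]
    simp
  · rw [fwdDiff_iter_degree_eq_factorial]
    simp [mul_comm]

theorem sum_alternating_choose_div (K : ℕ) {t : ℝ} (ht : ∀ i ≤ K, t - (i : ℝ) ≠ 0) :
    ∑ I ∈ range (K + 1), (-1) ^ (K - I) * (K.choose I : ℝ) * (1 / (t - I)) =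
      K ! / ∏ i ∈ range (K + 1), (t - i) := by
  have key (n : ℕ) : ∀ x : ℝ, (∀ i ≤ n, t - x - (i : ℝ) ≠ 0) →
      (fwdDiff (1 : ℝ))^[n] (fun x => 1 / (t - x)) x = n ! / ∏ i ∈ range (n + 1), (t - x - i) := by
    induction n with
    | zero => simp
    | succ n ih =>
      intro x hx
      have e (i : ℕ) : t - (x + 1) - i = t - x - (i + 1 : ℕ) := by push_cast; ring
      rw [Function.iterate_succ_apply', fwdDiff, ih x fun i hi => hx i (by omega),
        ih (x + 1) fun i hi => by rw [e]; exact hx _ (by omega)]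
      simp only [e]
      have h0 : ∏ i ∈ range (n + 1), (t - x - (i : ℝ)) ≠ 0 :=
        prod_ne_zero_iff.2 fun i hi => hx i (by have := mem_range.1 hi; omega)
      have h1 : ∏ i ∈ range (n + 1), (t - x - ((i + 1 : ℕ) : ℝ)) ≠ 0 :=
        prod_ne_zero_iff.2 fun i hi => hx _ (by have := mem_range.1 hi; omega)
      have h2 := prod_range_succ (fun i : ℕ => t - x - (i : ℝ)) (n + 1)
      have h3 := prod_range_succ' (fun i : ℕ => t - x - (i : ℝ)) (n + 1)
      have h4 := hx (n + 1) le_rfl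
      have h5 := hx 0 (by omega)
      rw [h2, Nat.factorial_succ]
      rw [h2] at h3
      rw [div_sub_div _ _ h1 h0, div_eq_div_iff (mul_ne_zero h1 h0) (mul_ne_zero h0 h4)]
      push_cast at *
      linear_combination ((n ! : ℝ) * ∏ i ∈ range (n + 1), (t - x - (i : ℝ))) * h3
  have := key K 0 (by simpa using ht)
  rw [fwdDiff_iter_eq_sum_shift] at this
  simpa using this

/-- Write `Q = Q(t) + (X - t) R`. The polynomial part `R` has degree below `K` and is killed by the
difference, so only the pole `Q(t) / (t - I)` contributes. -/
theorem sum_alternating_choose_mul_eval_div {K : ℕ} {Q : ℝ[X]} (hQ : Q.natDegree ≤ K) {t : ℝ}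
    (ht : ∀ i ≤ K, t - (i : ℝ) ≠ 0) :
    ∑ I ∈ range (K + 1), (-1) ^ (K - I) * (K.choose I : ℝ) * (Q.eval (I : ℝ) / (t - I)) =
      K ! * Q.eval t / ∏ i ∈ range (K + 1), (t - i) := by
  set R := Q /ₘ (X - C t)
  have hQR : C (Q.eval t) + (X - C t) * R = Q := by
    rw [← modByMonic_X_sub_C_eq_C_eval]
    exact modByMonic_add_div Q (X - C t)
  have hR : R.natDegree ≤ K := by
    rw [natDegree_divByMonic Q (monic_X_sub_C t)]
    omega
  have hRK : R.coeff K = 0 := by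
    have h1 : Q.coeff (K + 1) = 0 := coeff_eq_zero_of_natDegree_lt (by omega)
    have h2 : R.coeff (K + 1) = 0 := coeff_eq_zero_of_natDegree_lt (by omega)
    rw [← hQR, coeff_add, sub_mul, coeff_sub, coeff_X_mul, coeff_C_mul, h2, coeff_C_succ] at h1
    linarith
  have h := sum_alternating_choose_mul_eval hR
  rw [hRK, mul_zero] at h
  have heval (I : ℕ) (hI : I ≤ K) : Q.eval (I : ℝ) / (t - I) =
      Q.eval t * (1 / (t - I)) - R.eval (I : ℝ) := by
    have h1 := ht I hI
    have h2 := congrArg (eval (I : ℝ)) hQR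
    simp only [eval_add, eval_C, eval_mul, eval_sub, eval_X] at h2
    rw [← h2]
    field_simp
    ring
  calc _ = Q.eval t * ∑ I ∈ range (K + 1), (-1) ^ (K - I) * (K.choose I : ℝ) * (1 / (t - I)) -
        ∑ I ∈ range (K + 1), (-1) ^ (K - I) * (K.choose I : ℝ) * R.eval (I : ℝ) := by
        rw [mul_sum, ← sum_sub_distrib]
        refine sum_congr rfl fun I hI => ?_
        rw [heval I (by have := mem_range.1 hI; omega)]
        ring
    _ = _ := by
        rw [h, sum_alternating_choose_div K ht]
        ring

theorem Gamma_add_nat {x : ℝ} (n : ℕ) (hx : ∀ i < n, x + (i : ℝ) ≠ 0) :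
    Gamma (x + n) = (ascPochhammer ℝ n).eval x * Gamma x := by
  induction n with
  | zero => simp
  | succ n ih =>
    rw [ascPochhammer_succ_eval, Nat.cast_succ, ← add_assoc, Gamma_add_one (hx n (by omega)),
      ih fun i hi => hx i (by omega)]
    ring

theorem Gamma_add_nat_of_pos {x : ℝ} (n : ℕ) (hx : 0 < x) :
    Gamma (x + n) = (ascPochhammer ℝ n).eval x * Gamma x :=
  Gamma_add_nat n fun _ _ => by positivity

/-- Both sides are `Γ(x)` times two Pochhammer symbols. The second alternative serves row `0`, where
`x` may be a pole or negative: as `j, m ≥ 1`, the argument is shifted to `x + 1` and both sides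
share the factor `x`. -/
theorem Gamma_add_mul_ascPochhammer {x : ℝ} {j m : ℕ} (h : 0 < x ∨ (-1 < x ∧ 1 ≤ j ∧ 1 ≤ m)) :
    Gamma (x + j) * (ascPochhammer ℝ m).eval x = Gamma (x + m) * (ascPochhammer ℝ j).eval x := by
  rcases h with h | ⟨h, hj, hm⟩
  · rw [Gamma_add_nat_of_pos _ h, Gamma_add_nat_of_pos _ h]
    ring
  · obtain ⟨j, rfl⟩ := Nat.exists_eq_add_of_le' hj
    obtain ⟨m, rfl⟩ := Nat.exists_eq_add_of_le' hm
    have e (n : ℕ) : x + (n + 1 : ℕ) = (x + 1) + n := by push_cast; ring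
    rw [e, e, Gamma_add_nat_of_pos _ (by linarith), Gamma_add_nat_of_pos _ (by linarith),
      ascPochhammer_succ_left, ascPochhammer_succ_left]
    simp only [eval_mul, eval_X, eval_comp, eval_add, eval_one]
    ring

theorem ascPochhammer_eval_reflect (n : ℕ) (y : ℝ) :
    (ascPochhammer ℝ n).eval (1 - y - n) = (-1) ^ n * (ascPochhammer ℝ n).eval y := by
  have h := ascPochhammer_eval_neg_eq_descPochhammer ℝ (y + n - 1) n
  rw [descPochhammer_eval_eq_ascPochhammer] at h
  rwa [show -(y + n - 1) = 1 - y - n by ring, show y + (n : ℝ) - 1 - n + 1 = y by ring] at h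

theorem prod_range_sub_eq_ascPochhammer (n : ℕ) (t : ℝ) :
    ∏ i ∈ range n, (t - i) = (ascPochhammer ℝ n).eval (t - n + 1) := by
  rw [← descPochhammer_eval_eq_ascPochhammer, descPochhammer_eval_eq_prod_range]

theorem monic_shifted_ascPochhammer (n : ℕ) (c : ℝ) :
    ((ascPochhammer ℝ n).comp (X + C c)).Monic :=
  (monic_ascPochhammer ℝ n).comp_X_add_C c

theorem natDegree_shifted_ascPochhammer (n : ℕ) (c : ℝ) :
    ((ascPochhammer ℝ n).comp (X + C c)).natDegree = n := by
  rw [natDegree_comp, natDegree_X_add_C, mul_one, ascPochhammer_natDegree]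

theorem natDegree_sub_X_mul_ascPochhammer_le (j : ℕ) (d c : ℝ) :
    ((C d - X) * (ascPochhammer ℝ j).comp (X + C c)).natDegree ≤ j + 1 := by
  refine natDegree_mul_le.trans ?_
  rw [natDegree_shifted_ascPochhammer]
  have : (C d - X : ℝ[X]).natDegree ≤ 1 := by compute_degree
  omega

theorem coeff_sub_X_mul_ascPochhammer (j : ℕ) (d c : ℝ) :
    ((C d - X) * (ascPochhammer ℝ j).comp (X + C c)).coeff (j + 1) = -1 := by
  have h1 := (monic_shifted_ascPochhammer j c).coeff_natDegree
  have h2 := natDegree_shifted_ascPochhammer j c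
  rw [h2] at h1
  rw [sub_mul, coeff_sub, coeff_X_mul, coeff_C_mul, h1, coeff_eq_zero_of_natDegree_lt (by omega)]
  ring

/-- The Mehta–Wang Pfaffian. -/
theorem pfaffian_of_Gamma (N : ℕ) (b : ℝ) (hb : -1 < b) (A : ℕ → ℕ → ℝ)
    (hA : ∀ i j, i + j ≠ 0 → A i j = ((j : ℝ) - i) * Gamma ((i : ℝ) + j + b)) (hA0 : A 0 0 = 0) :
    pfaffian N (Matrix.of fun i j => A i j) =
      ∏ i ∈ range N, Gamma (2 * (i : ℝ) + 2) * Gamma (2 * (i : ℝ) + b + 1) := by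
  have hA' (i j : ℕ) : A i j = ((j : ℝ) - i) * Gamma ((i : ℝ) + j + b) := by
    by_cases h : i + j = 0
    · obtain ⟨rfl, rfl⟩ : i = 0 ∧ j = 0 := by omega
      simp [hA0]
    · exact hA i j h
  -- The Pochhammer prefactor turns the entry into a constant times `(j - i) (i + b)_j`, of degree
  -- `j + 1` in `i`. With `k = 2K+1` this is below `k` for `j < 2K` and equals `k`, with leading
  -- coefficient `-1`, for `j = 2K`.
  have hterm (k i j : ℕ) (hi : i ≤ k) (hk : 1 ≤ k) :
      (ascPochhammer ℝ (k - i)).eval (b + i) * A i j =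
        Gamma (b + k) * eval (i : ℝ) ((C (j : ℝ) - X) * (ascPochhammer ℝ j).comp (X + C b)) := by
    simp only [eval_mul, eval_sub, eval_C, eval_X, eval_comp, eval_add, hA']
    by_cases h : i + j = 0
    · obtain ⟨rfl, rfl⟩ : i = 0 ∧ j = 0 := by omega
      simp
    · have := Gamma_add_mul_ascPochhammer (x := b + i) (j := j) (m := k - i) (by
        rcases Nat.eq_zero_or_pos i with rfl | hi'
        · exact Or.inr ⟨by simpa using hb, by omega, by omega⟩
        · have : (1 : ℝ) ≤ i := by exact_mod_cast hi'
          exact Or.inl (by linarith))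
      rw [Nat.cast_sub hi] at this
      rw [show b + i + ((k : ℝ) - i) = b + k by ring] at this
      rw [show (i : ℝ) + j + b = b + i + j by ring, add_comm (i : ℝ) b]
      linear_combination ((j : ℝ) - i) * this
  have hsum (K j : ℕ) : ∑ i ∈ range (2 * K + 2), ((-1) ^ (2 * K + 1 - i) *
      ((2 * K + 1).choose i : ℝ) * (ascPochhammer ℝ (2 * K + 1 - i)).eval (b + i)) * A i j =
      Gamma (b + (2 * K + 1 : ℕ)) * ∑ i ∈ range (2 * K + 1 + 1), (-1) ^ (2 * K + 1 - i) *
        ((2 * K + 1).choose i : ℝ) *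
        eval (i : ℝ) ((C (j : ℝ) - X) * (ascPochhammer ℝ j).comp (X + C b)) := by
    rw [mul_sum]
    refine sum_congr rfl fun i hi => ?_
    rw [mul_assoc, hterm _ _ _ (by have := mem_range.1 hi; omega) (by omega)]
    ring
  refine pfaffian_eq_prod N A (fun K i => (-1) ^ (2 * K + 1 - i) *
      ((2 * K + 1).choose i : ℝ) * (ascPochhammer ℝ (2 * K + 1 - i)).eval (b + i)) _
    (fun i j => ?_) (fun K _ => ?_) (fun K _ j hj => ?_) (fun K _ => ?_)
  · rw [hA', hA', add_comm (j : ℝ)]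
    ring
  · simp
  · have hd := natDegree_sub_X_mul_ascPochhammer_le j j b
    rw [hsum, sum_alternating_choose_mul_eval (by omega),
      coeff_eq_zero_of_natDegree_lt (by omega)]
    simp
  · rw [hsum, sum_alternating_choose_mul_eval (natDegree_sub_X_mul_ascPochhammer_le _ _ _),
      coeff_sub_X_mul_ascPochhammer]
    have h := Gamma_nat_eq_factorial (2 * K + 1)
    push_cast at h ⊢
    rw [← h, show (2 : ℝ) * K + 1 + 1 = 2 * K + 2 by ring,
      show b + (2 * (K : ℝ) + 1) = 2 * K + b + 1 by ring]
    ring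

theorem pfaffian_of_beta (N : ℕ) (a b : ℝ) (ha : -2 < a) (hb : -2 < b) (h2 : a + b ≠ -2)
    (h3 : a + b ≠ -3) (A : ℕ → ℕ → ℝ)
    (hA : ∀ i j, i + j ≠ 0 → A i j = ((j : ℝ) - i) *
      (Gamma ((i : ℝ) + j + a + 1) * Gamma (b + 2) / Gamma ((i : ℝ) + j + a + b + 3)))
    (hA0 : A 0 0 = 0) :
    pfaffian N (Matrix.of fun i j => A i j) =
      ∏ i ∈ range N, (a + b + 4 * i + 2) *
        ((Gamma (a + 2 * (i : ℝ) + 2) * Gamma (b + 2 * (i : ℝ) + 2) *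
          Gamma (2 * (i : ℝ) + 2) * Gamma (a + b + 2 * (i : ℝ) + 2)) /
            (Gamma (a + b + 4 * (i : ℝ) + 3) * Gamma (a + b + 4 * (i : ℝ) + 4))) := by
  have hA' (i j : ℕ) : A i j = ((j : ℝ) - i) *
      (Gamma ((i : ℝ) + j + a + 1) * Gamma (b + 2) / Gamma ((i : ℝ) + j + a + b + 3)) := by
    by_cases h : i + j = 0
    · obtain ⟨rfl, rfl⟩ : i = 0 ∧ j = 0 := by omega
      simp [hA0]
    · exact hA i j h
  -- Since `a + b + 2 > -2`, adding a natural number can give zero only for `0` or `1`: exactly the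
  -- two excluded values of `a + b`.
  have hne {x : ℝ} {m : ℕ} (hx : x = a + b + 2 + m) (i : ℕ) : x + i ≠ 0 := by
    rw [hx]
    intro h
    have : ((m + i : ℕ) : ℝ) < 2 := by push_cast; linarith
    have : m + i < 2 := by exact_mod_cast this
    have : ((m + i : ℕ) : ℝ) = 0 ∨ ((m + i : ℕ) : ℝ) = 1 := by
      rcases (show m + i = 0 ∨ m + i = 1 by omega) with h | h <;> simp [h]
    push_cast at this
    rcases this with h | h
    · exact h2 (by linarith)
    · exact h3 (by linarith)
  have hG {x : ℝ} {m : ℕ} (hx : x = a + b + 2 + m) : Gamma x ≠ 0 :=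
    Gamma_ne_zero fun i h => hne hx i (by rw [h]; ring)
  have hfactor (k i j : ℕ) (hi : i ≤ k) (hk : 1 ≤ k) :
      (ascPochhammer ℝ (k - i)).eval (a + 1 + i) * (((j : ℝ) - i) * Gamma ((i : ℝ) + j + a + 1)) =
        Gamma (a + 1 + k) *
          eval (i : ℝ) ((C (j : ℝ) - X) * (ascPochhammer ℝ j).comp (X + C (a + 1))) := by
    simp only [eval_mul, eval_sub, eval_C, eval_X, eval_comp, eval_add]
    by_cases h : i + j = 0
    · obtain ⟨rfl, rfl⟩ : i = 0 ∧ j = 0 := by omega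
      simp
    · have := Gamma_add_mul_ascPochhammer (x := a + 1 + i) (j := j) (m := k - i) (by
        rcases Nat.eq_zero_or_pos i with rfl | hi'
        · exact Or.inr ⟨by push_cast; linarith, by omega, by omega⟩
        · have : (1 : ℝ) ≤ i := by exact_mod_cast hi'
          exact Or.inl (by linarith))
      rw [Nat.cast_sub hi] at this
      rw [show a + 1 + i + ((k : ℝ) - i) = a + 1 + k by ring] at this
      rw [show (i : ℝ) + j + a + 1 = a + 1 + i + j by ring, add_comm (i : ℝ) (a + 1)]
      linear_combination ((j : ℝ) - i) * this
  -- The Gamma numerator is there to cancel the denominator of the entry; the Gamma denominator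
  -- normalises the coefficient at `i = 2K+1` to `1`.
  let P : ℕ → ℕ → ℝ := fun K i => (-1) ^ (2 * K + 1 - i) * ((2 * K + 1).choose i : ℝ) *
    (ascPochhammer ℝ (2 * K + 1 - i)).eval (a + 1 + i) *
      (Gamma (a + b + (2 * K + 1 : ℕ) + i + 1) / Gamma (a + b + 2 * (2 * K + 1 : ℕ) + 1))
  have hterm (K i j : ℕ) (hi : i ≤ 2 * K + 1) : P K i * A i j =
      (-1) ^ (2 * K + 1 - i) * ((2 * K + 1).choose i : ℝ) *
      (eval (i : ℝ) ((C (j : ℝ) - X) * (ascPochhammer ℝ j).comp (X + C (a + 1))) *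
        (Gamma (a + b + (2 * K + 1 : ℕ) + i + 1) / Gamma ((i : ℝ) + j + a + b + 3))) *
      (Gamma (a + 1 + (2 * K + 1 : ℕ)) * Gamma (b + 2) /
        Gamma (a + b + 2 * (2 * K + 1 : ℕ) + 1)) := by
    have := hfactor (2 * K + 1) i j hi (by omega)
    simp only [P, hA']
    linear_combination (-1) ^ (2 * K + 1 - i) * ((2 * K + 1).choose i : ℝ) *
      (Gamma (a + b + (2 * K + 1 : ℕ) + i + 1) / Gamma ((i : ℝ) + j + a + b + 3)) * Gamma (b + 2) /
        Gamma (a + b + 2 * (2 * K + 1 : ℕ) + 1) * this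
  refine pfaffian_eq_prod N A P _ (fun i j => ?_) (fun K _ => ?_) (fun K _ j hj => ?_)
    (fun K _ => ?_)
  · rw [hA', hA', add_comm (j : ℝ)]
    ring
  · have : Gamma (a + b + 2 * (2 * K + 1 : ℕ) + 1) ≠ 0 :=
      hG (m := 4 * K + 1) (by push_cast; ring)
    simp only [P, tsub_self, pow_zero, Nat.choose_self, ascPochhammer_zero, eval_one]
    rw [show a + b + ((2 * K + 1 : ℕ) : ℝ) + (2 * K + 1 : ℕ) + 1 =
      a + b + 2 * (2 * K + 1 : ℕ) + 1 by ring, div_self this]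
    simp
  -- For `j < 2K` the Gamma quotient is a polynomial of degree `2K - 1 - j`, so the total degree is
  -- at most `2K`, below the order `2K+1` of the difference.
  · have hratio (i : ℕ) :
        eval (i : ℝ) ((C (j : ℝ) - X) * (ascPochhammer ℝ j).comp (X + C (a + 1))) *
        (Gamma (a + b + (2 * K + 1 : ℕ) + i + 1) / Gamma ((i : ℝ) + j + a + b + 3)) =
        eval (i : ℝ) ((C (j : ℝ) - X) * (ascPochhammer ℝ j).comp (X + C (a + 1)) *
          (ascPochhammer ℝ (2 * K - 1 - j)).comp (X + C (j + a + b + 3))) := by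
      have hx : (i : ℝ) + j + a + b + 3 = a + b + 2 + (i + j + 1 : ℕ) := by push_cast; ring
      rw [eval_mul (q := (ascPochhammer ℝ (2 * K - 1 - j)).comp _),
        eval_comp (p := ascPochhammer ℝ (2 * K - 1 - j))]
      simp only [eval_add, eval_X, eval_C]
      have := Gamma_add_nat (2 * K - 1 - j) fun n _ => hne hx n
      rw [show a + b + ((2 * K + 1 : ℕ) : ℝ) + i + 1 =
        (i : ℝ) + j + a + b + 3 + ((2 * K - 1 - j : ℕ) : ℝ) by
          rw [Nat.cast_sub (by omega), Nat.cast_sub (by omega)]; push_cast; ring, this,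
        mul_div_assoc, div_self (hG hx), mul_one]
      simp only [add_assoc]
    rw [sum_congr rfl fun i hi => by
      rw [hterm K i j (by have := mem_range.1 hi; omega), hratio], ← sum_mul]
    have hd := natDegree_sub_X_mul_ascPochhammer_le j j (a + 1)
    have hd' := natDegree_shifted_ascPochhammer (2 * K - 1 - j) (j + a + b + 3)
    have hd'' := natDegree_mul_le (p := (C (j : ℝ) - X) * (ascPochhammer ℝ j).comp (X + C (a + 1)))
      (q := (ascPochhammer ℝ (2 * K - 1 - j)).comp (X + C (j + a + b + 3)))
    rw [sum_alternating_choose_mul_eval (by omega),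
      coeff_eq_zero_of_natDegree_lt (by omega)]
    simp
  -- At `j = 2K` the quotient is `Γ(s) / Γ(s + 1) = 1 / s` with `s = i - t`: one simple pole in `i`,
  -- at `t`.
  · obtain ⟨t, ht⟩ : ∃ t : ℝ, t = -(a + b + (2 * K + 1 : ℕ) + 1) := ⟨_, rfl⟩
    have hs : -t = a + b + 2 + (2 * K : ℕ) := by rw [ht]; push_cast; ring
    have hratio (i : ℕ) : Gamma (a + b + (2 * K + 1 : ℕ) + i + 1) /
        Gamma ((i : ℝ) + (2 * K : ℕ) + a + b + 3) = - (1 / (t - i)) := by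
      have hx : a + b + ((2 * K + 1 : ℕ) : ℝ) + i + 1 = a + b + 2 + (2 * K + i : ℕ) := by
        push_cast; ring
      have h0 := hne hx 0
      have h1 := hG hx
      rw [Nat.cast_zero, add_zero] at h0
      rw [show (i : ℝ) + (2 * K : ℕ) + a + b + 3 = (a + b + (2 * K + 1 : ℕ) + i + 1) + 1 by
        push_cast; ring, Gamma_add_one h0,
        show t - i = -(a + b + (2 * K + 1 : ℕ) + i + 1) by rw [ht]; ring]
      field_simp
    have hti (i : ℕ) : t - i ≠ 0 := fun h => hne hs i (by linarith)
    rw [sum_congr rfl fun i hi => by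
      rw [hterm K i (2 * K) (by have := mem_range.1 hi; omega), hratio, mul_neg, mul_one_div,
        mul_neg, neg_mul], sum_neg_distrib, ← sum_mul,
      sum_alternating_choose_mul_eval_div (natDegree_sub_X_mul_ascPochhammer_le _ _ _)
        fun i _ => hti i]
    congr 1
    have hprod : ∏ i ∈ range (2 * K + 1 + 1), (t - (i : ℝ)) =
        Gamma (a + b + 4 * K + 4) / Gamma (a + b + 2 * K + 2) := by
      have h1 := ascPochhammer_eval_reflect (2 * K + 1 + 1) (-t)
      have h2 := Gamma_add_nat (2 * K + 1 + 1) fun i _ => hne hs i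
      rw [show a + b + 4 * (K : ℝ) + 4 = -t + ((2 * K + 1 + 1 : ℕ) : ℝ) by
        rw [ht]; push_cast; ring, h2, show a + b + 2 * (K : ℝ) + 2 = -t by rw [ht]; push_cast; ring,
        mul_div_assoc, div_self (hG hs), mul_one, prod_range_sub_eq_ascPochhammer,
        show t - ((2 * K + 1 + 1 : ℕ) : ℝ) + 1 = 1 - -t - ((2 * K + 1 + 1 : ℕ) : ℝ) by ring, h1,
        Even.neg_one_pow (by exact ⟨K + 1, by ring⟩), one_mul]
    -- At the pole, `t + a + 1 = 1 - (b + 2) - 2K`, so reflection gives `(b + 2)_(2K)`; the linear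
    -- factor gives `a + b + 4K + 2`.
    have heval : eval t ((C ((2 * K : ℕ) : ℝ) - X) *
        (ascPochhammer ℝ (2 * K)).comp (X + C (a + 1))) =
        (a + b + 4 * K + 2) * (Gamma (b + 2 * K + 2) / Gamma (b + 2)) := by
      simp only [eval_mul, eval_sub, eval_C, eval_X, eval_comp, eval_add]
      have h1 := ascPochhammer_eval_reflect (2 * K) (b + 2)
      have h2 := Gamma_add_nat_of_pos (x := b + 2) (2 * K) (by linarith)
      rw [show b + 2 * (K : ℝ) + 2 = b + 2 + ((2 * K : ℕ) : ℝ) by push_cast; ring, h2,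
        mul_div_assoc, div_self (Gamma_pos_of_pos (by linarith)).ne', mul_one,
        show t + (a + 1) = 1 - (b + 2) - ((2 * K : ℕ) : ℝ) by rw [ht]; push_cast; ring, h1,
        Even.neg_one_pow (by simp), one_mul, ht]
      push_cast
      ring
    have hfac := Gamma_nat_eq_factorial (2 * K + 1)
    have g1 : Gamma (b + 2) ≠ 0 := (Gamma_pos_of_pos (by linarith)).ne'
    have g2 : Gamma (a + b + 2 * K + 2) ≠ 0 := hG (m := 2 * K) (by push_cast; ring)
    have g3 : Gamma (a + b + 4 * K + 4) ≠ 0 := hG (m := 4 * K + 2) (by push_cast; ring)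
    have g4 : Gamma (a + b + 4 * K + 3) ≠ 0 := hG (m := 4 * K + 1) (by push_cast; ring)
    rw [hprod, heval, ← hfac]
    push_cast
    rw [show (2 : ℝ) * K + 1 + 1 = 2 * K + 2 by ring,
      show a + 1 + (2 * (K : ℝ) + 1) = a + 2 * K + 2 by ring,
      show a + b + 2 * (2 * (K : ℝ) + 1) + 1 = a + b + 4 * K + 3 by ring]
    field_simp

end PochhammerSums

/-! ### Hermite and Cauchy Pfaffians via the checkerboard pattern. -/

section EvenWeights

open Finset Polynomial

/-- The factor `y + c` divides the right side: through the Pochhammer symbol if `J > 0`, through the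
linear factor if `J = 0`. Dividing it out lowers the degree from `J + 1` to `J`. -/
theorem exists_polynomial_mul_add_eq (J : ℕ) (c : ℝ) : ∃ R : ℝ[X], R.natDegree ≤ J ∧
    R.coeff J = -2 ∧ ∀ y : ℝ, R.eval y * (y + c) =
      2 * (J - (y + c)) * (ascPochhammer ℝ J).eval (y + c) := by
  cases J with
  | zero =>
    refine ⟨C (-2), by simp, by simp, fun y => ?_⟩
    simp
    ring
  | succ J =>
    refine ⟨C 2 * ((C ((J + 1 : ℕ) - c) - X) * (ascPochhammer ℝ J).comp (X + C (c + 1))),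
      ?_, ?_, fun y => ?_⟩
    · exact (natDegree_C_mul_le _ _).trans (natDegree_sub_X_mul_ascPochhammer_le _ _ _)
    · rw [coeff_C_mul, coeff_sub_X_mul_ascPochhammer]
      norm_num
    · rw [ascPochhammer_succ_left]
      simp only [eval_mul, eval_sub, eval_C, eval_X, eval_comp, eval_add, eval_one, add_assoc]
      ring

/-- Data shared by the even weights: `(J - I - 1/2) Γ(I+J+1/2)` times the odd-row coefficient
`(I+3/2)_{K-I}` is a constant times a polynomial in `I` of degree `J`. -/
theorem exists_polynomial_half (J : ℕ) : ∃ R : ℝ[X], R.natDegree ≤ J ∧ R.coeff J = -2 ∧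
    (∀ y : ℝ, R.eval y * (y + 1 / 2) =
      2 * (J - (y + 1 / 2)) * (ascPochhammer ℝ J).eval (y + 1 / 2)) ∧
    ∀ K I : ℕ, I ≤ K → (ascPochhammer ℝ (K - I)).eval ((I : ℝ) + 3 / 2) *
      ((2 * J - (2 * I + 1)) * Gamma ((I : ℝ) + J + 1 / 2)) =
        Gamma ((K : ℝ) + 3 / 2) * R.eval (I : ℝ) := by
  obtain ⟨R, h1, h2, h3⟩ := exists_polynomial_mul_add_eq J (1 / 2)
  refine ⟨R, h1, h2, h3, fun K I hI => ?_⟩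
  have hx : (0 : ℝ) < I + 1 / 2 := by positivity
  have g1 := Gamma_add_nat_of_pos (x := (I : ℝ) + 3 / 2) (K - I) (by positivity)
  have g2 := Gamma_add_nat_of_pos J hx
  have g3 := Gamma_add_one hx.ne'
  rw [Nat.cast_sub hI, show (I : ℝ) + 3 / 2 + (K - I) = K + 3 / 2 by ring] at g1
  rw [show (I : ℝ) + 1 / 2 + J = I + J + 1 / 2 by ring] at g2
  rw [show (I : ℝ) + 1 / 2 + 1 = I + 3 / 2 by ring] at g3
  rw [g1, g2, g3]
  linear_combination -(ascPochhammer ℝ (K - I)).eval ((I : ℝ) + 3 / 2) * Gamma ((I : ℝ) + 1 / 2) *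
    h3 I

theorem pfaffian_of_Gamma_half (N : ℕ) (A : ℕ → ℕ → ℝ) (hA : ∀ i j, A j i = -A i j)
    (hodd : ∀ I J, A (2 * I + 1) (2 * J + 1) = 0)
    (heven : ∀ I J : ℕ, A (2 * I + 1) (2 * J) =
      (2 * J - (2 * I + 1)) * Gamma ((I : ℝ) + J + 1 / 2)) :
    pfaffian N (Matrix.of fun i j => A i j) =
      ∏ K ∈ range N, 2 * (K ! : ℝ) * Gamma ((K : ℝ) + 3 / 2) := by
  refine pfaffian_eq_prod_of_checkerboard N A (fun K I => (-1) ^ (K - I) * (K.choose I : ℝ) *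
    (ascPochhammer ℝ (K - I)).eval ((I : ℝ) + 3 / 2)) _ hA hodd (fun K _ => by simp)
    (fun K _ J hJ => ?_) (fun K _ => ?_)
  · obtain ⟨R, h1, h2, -, h3⟩ := exists_polynomial_half J
    have := sum_alternating_choose_mul_eval (K := K) (Q := R) (by omega)
    rw [coeff_eq_zero_of_natDegree_lt (by omega)] at this
    calc _ = Gamma ((K : ℝ) + 3 / 2) * ∑ I ∈ range (K + 1),
        (-1) ^ (K - I) * (K.choose I : ℝ) * R.eval (I : ℝ) := by
          rw [mul_sum]
          refine sum_congr rfl fun I hI => ?_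
          rw [heven, mul_assoc, h3 K I (by have := mem_range.1 hI; omega)]
          ring
      _ = 0 := by rw [this, mul_zero, mul_zero]
  · obtain ⟨R, h1, h2, -, h3⟩ := exists_polynomial_half K
    have := sum_alternating_choose_mul_eval (K := K) (Q := R) (by omega)
    calc _ = Gamma ((K : ℝ) + 3 / 2) * ∑ I ∈ range (K + 1),
        (-1) ^ (K - I) * (K.choose I : ℝ) * R.eval (I : ℝ) := by
          rw [mul_sum]
          refine sum_congr rfl fun I hI => ?_
          rw [heven, mul_assoc, h3 K I (by have := mem_range.1 hI; omega)]
          ring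
      _ = _ := by
          rw [this, h2]
          ring

/-- The even entries are prescribed only for `I, J < N`, the range in which the Cauchy moments
converge. -/
theorem pfaffian_of_Gamma_mul_Gamma (N : ℕ) (a : ℝ) (ha : 2 * (N : ℝ) - 1 / 2 < a)
    (A : ℕ → ℕ → ℝ) (hA : ∀ i j, A j i = -A i j)
    (hodd : ∀ I J, A (2 * I + 1) (2 * J + 1) = 0)
    (heven : ∀ I J : ℕ, I < N → J < N → A (2 * I + 1) (2 * J) = (2 * J - (2 * I + 1)) *
      (Gamma ((I : ℝ) + J + 1 / 2) * Gamma (a - 3 / 2 - I - J) / Gamma (a - 1))) :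
    pfaffian N (Matrix.of fun i j => A i j) =
      ∏ K ∈ range N, 2 * (K ! : ℝ) * Gamma ((K : ℝ) + 3 / 2) * (a - 2 * K - 1) *
        Gamma (a - 2 * K - 1 / 2) * Gamma (a - 2 * K - 3 / 2) /
          (Gamma (a - K) * Gamma (a - K - 1 / 2)) := by
  have hKa {K : ℕ} (hK : K < N) : 2 * (K : ℝ) + 3 / 2 < a := by
    have : (K : ℝ) + 1 ≤ N := by exact_mod_cast hK
    linarith
  -- Dividing by `Γ(a - K - 1/2 - I)` turns the second Gamma factor of the entry into a polynomial
  -- of degree `K - 1 - J` if `J < K`, and into `1 / (t - I)` with `t = a - 3/2 - K` if `J = K`.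
  let P : ℕ → ℕ → ℝ := fun K I => (-1) ^ (K - I) * (K.choose I : ℝ) *
    (ascPochhammer ℝ (K - I)).eval ((I : ℝ) + 3 / 2) *
      (Gamma (a - 2 * K - 1 / 2) / Gamma (a - K - 1 / 2 - I))
  have hterm {K I J : ℕ} (hK : K < N) (hI : I ≤ K) (hJ : J ≤ K) {R : ℝ[X]}
      (hR : ∀ K I : ℕ, I ≤ K → (ascPochhammer ℝ (K - I)).eval ((I : ℝ) + 3 / 2) *
      ((2 * J - (2 * I + 1)) * Gamma ((I : ℝ) + J + 1 / 2)) =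
        Gamma ((K : ℝ) + 3 / 2) * R.eval (I : ℝ)) : P K I * A (2 * I + 1) (2 * J) =
      (-1) ^ (K - I) * (K.choose I : ℝ) *
        (R.eval (I : ℝ) * (Gamma (a - 3 / 2 - I - J) / Gamma (a - K - 1 / 2 - I))) *
      (Gamma ((K : ℝ) + 3 / 2) * Gamma (a - 2 * K - 1 / 2) / Gamma (a - 1)) := by
    rw [heven I J (by omega) (by omega)]
    simp only [P]
    linear_combination (-1) ^ (K - I) * (K.choose I : ℝ) *
      (Gamma (a - 2 * K - 1 / 2) / Gamma (a - K - 1 / 2 - I)) *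
        Gamma (a - 3 / 2 - I - J) / Gamma (a - 1) * hR K I hI
  refine pfaffian_eq_prod_of_checkerboard N A P _ hA hodd (fun K hK => ?_)
    (fun K hK J hJ => ?_) (fun K hK => ?_)
  · have := hKa hK
    have : Gamma (a - 2 * K - 1 / 2) ≠ 0 := (Gamma_pos_of_pos (by linarith)).ne'
    simp only [P, tsub_self, pow_zero, Nat.choose_self, ascPochhammer_zero, eval_one]
    rw [show a - (K : ℝ) - 1 / 2 - K = a - 2 * K - 1 / 2 by ring, div_self this]
    simp
  · obtain ⟨R, h1, h2, -, h3⟩ := exists_polynomial_half J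
    have hratio (I : ℕ) (hI : I ≤ K) :
        R.eval (I : ℝ) * (Gamma (a - 3 / 2 - I - J) / Gamma (a - K - 1 / 2 - I)) =
          (R * (ascPochhammer ℝ (K - 1 - J)).comp (C (a - K - 1 / 2) - X)).eval (I : ℝ) := by
      have hI' : (I : ℝ) ≤ K := by exact_mod_cast hI
      have hpos : 0 < a - K - 1 / 2 - I := by linarith [hKa hK]
      have := Gamma_add_nat_of_pos (K - 1 - J) hpos
      rw [show a - 3 / 2 - (I : ℝ) - J = a - K - 1 / 2 - I + ((K - 1 - J : ℕ) : ℝ) by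
        rw [Nat.cast_sub (by omega), Nat.cast_sub (by omega)]; push_cast; ring, this,
        mul_div_assoc, div_self (Gamma_pos_of_pos hpos).ne', mul_one, eval_mul]
      simp
    rw [sum_congr rfl fun I hI => by
      have hI' : I ≤ K := by have := mem_range.1 hI; omega
      rw [hterm hK hI' hJ.le h3, hratio I hI'], ← sum_mul]
    have hd : (C (a - K - 1 / 2) - X : ℝ[X]).natDegree ≤ 1 := by compute_degree
    have hd' : ((ascPochhammer ℝ (K - 1 - J)).comp (C (a - K - 1 / 2) - X)).natDegree ≤
        K - 1 - J := by
      rw [natDegree_comp, ascPochhammer_natDegree]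
      exact (Nat.mul_le_mul_left _ hd).trans (mul_one _).le
    have hd'' := natDegree_mul_le (p := R)
      (q := (ascPochhammer ℝ (K - 1 - J)).comp (C (a - K - 1 / 2) - X))
    rw [sum_alternating_choose_mul_eval (by omega), coeff_eq_zero_of_natDegree_lt (by omega)]
    simp
  · obtain ⟨R, h1, h2, h3, h4⟩ := exists_polynomial_half K
    have haK := hKa hK
    have hK0 : (0 : ℝ) ≤ K := Nat.cast_nonneg K
    obtain ⟨t, ht⟩ : ∃ t : ℝ, t = a - 3 / 2 - K := ⟨_, rfl⟩
    have htpos {I : ℕ} (hI : I ≤ K) : 0 < t - I := by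
      have hI' : (I : ℝ) ≤ K := by exact_mod_cast hI
      linarith
    have hratio (I : ℕ) (hI : I ≤ K) :
        Gamma (a - 3 / 2 - I - K) / Gamma (a - K - 1 / 2 - I) = 1 / (t - I) := by
      have hp := htpos hI
      rw [show a - K - 1 / 2 - (I : ℝ) = t - I + 1 by rw [ht]; ring, Gamma_add_one hp.ne',
        show a - 3 / 2 - (I : ℝ) - K = t - I by rw [ht]; ring]
      have := (Gamma_pos_of_pos hp).ne'
      field_simp
    rw [sum_congr rfl fun I hI => by
      have hI' : I ≤ K := by have := mem_range.1 hI; omega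
      rw [hterm hK hI' le_rfl h4, hratio I hI', mul_one_div], ← sum_mul,
      sum_alternating_choose_mul_eval_div h1 fun i hi => (htpos hi).ne']
    have hp := htpos le_rfl
    have hprod : ∏ i ∈ range (K + 1), (t - (i : ℝ)) =
        Gamma (a - K - 1 / 2) / Gamma (a - 2 * K - 3 / 2) := by
      have := Gamma_add_nat_of_pos (K + 1) hp
      rw [show a - K - 1 / 2 = t - K + (K + 1 : ℕ) by rw [ht]; push_cast; ring, this,
        show a - 2 * (K : ℝ) - 3 / 2 = t - K by rw [ht]; ring, mul_div_assoc,
        div_self (Gamma_pos_of_pos hp).ne', mul_one, prod_range_sub_eq_ascPochhammer]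
      congr 1
      push_cast
      ring
    have heval : R.eval t * Gamma (a - K) = -2 * (a - 2 * K - 1) * Gamma (a - 1) := by
      have e1 : t + 1 / 2 = a - K - 1 := by rw [ht]; ring
      have hq : 0 < a - K - 1 := by linarith
      have g1 := h3 t
      have g2 := Gamma_add_nat_of_pos K hq
      have g3 := Gamma_add_one hq.ne'
      rw [e1] at g1
      rw [show a - K - 1 + (K : ℝ) = a - 1 by ring] at g2
      rw [show a - K - 1 + 1 = a - K by ring] at g3
      rw [g2, g3]
      linear_combination Gamma (a - K - 1) * g1
    have p1 : Gamma (a - K) ≠ 0 := (Gamma_pos_of_pos (by linarith)).ne'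
    have p2 : Gamma (a - 1) ≠ 0 := (Gamma_pos_of_pos (by linarith)).ne'
    have p3 : Gamma (a - K - 1 / 2) ≠ 0 := (Gamma_pos_of_pos (by linarith)).ne'
    have p4 : Gamma (a - 2 * K - 3 / 2) ≠ 0 := (Gamma_pos_of_pos (by linarith)).ne'
    rw [hprod, (eq_div_iff p1).2 heval]
    field_simp

end EvenWeights

/-! ### Convergence and values of the moments. -/

section Moments

open Set

theorem hasMoment_laguerreWeight {a : ℝ} (ha : -2 < a) (n : ℕ) :
    HasMoment (laguerreWeight a) n (Gamma ((n : ℝ) + a + 2)) := by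
  have hs : 0 < (n : ℝ) + a + 2 := by have : (0 : ℝ) ≤ n := Nat.cast_nonneg n; linarith
  have hfun : (fun x : ℝ => x ^ n * laguerreWeight a x) =
      (Ioi 0).indicator fun x => Real.exp (-x) * x ^ ((n : ℝ) + a + 2 - 1) := by
    ext x
    by_cases hx : x ∈ Ioi (0 : ℝ)
    · rw [laguerreWeight, indicator_of_mem hx, indicator_of_mem hx, mul_left_comm, ← mul_assoc,
        mul_comm, ← rpow_natCast, ← rpow_add hx]
      ring_nf
    · rw [laguerreWeight, indicator_of_notMem hx, indicator_of_notMem hx, mul_zero]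
  refine ⟨?_, ?_⟩
  · rw [hfun, integrable_indicator_iff measurableSet_Ioi]
    exact GammaIntegral_convergent hs
  · rw [moment, hfun, integral_indicator measurableSet_Ioi, Gamma_eq_integral hs]

/-- Both claims are read off from the beta density having total mass `1`. -/
theorem integrableOn_and_integral_beta {p q : ℝ} (hp : 0 < p) (hq : 0 < q) :
    IntegrableOn (fun x : ℝ => x ^ (p - 1) * (1 - x) ^ (q - 1)) (Ioo 0 1) ∧
      ∫ x in Ioo (0 : ℝ) 1, x ^ (p - 1) * (1 - x) ^ (q - 1) =
        Gamma p * Gamma q / Gamma (p + q) := by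
  have hB := ProbabilityTheory.beta_pos hp hq
  have hfun : ProbabilityTheory.betaPDFReal p q = (Ioo 0 1).indicator fun x =>
      (1 / ProbabilityTheory.beta p q) * (x ^ (p - 1) * (1 - x) ^ (q - 1)) := by
    ext x
    by_cases hx : x ∈ Ioo (0 : ℝ) 1
    · rw [indicator_of_mem hx, ProbabilityTheory.betaPDFReal, if_pos ⟨hx.1, hx.2⟩, mul_assoc]
    · rw [indicator_of_notMem hx, ProbabilityTheory.betaPDFReal, if_neg fun h => hx ⟨h.1, h.2⟩]
  have hnonneg : 0 ≤ ProbabilityTheory.betaPDFReal p q := fun x => by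
    by_cases hx : 0 < x ∧ x < 1
    · exact (ProbabilityTheory.betaPDFReal_pos hx.1 hx.2 hp hq).le
    · rw [ProbabilityTheory.betaPDFReal, if_neg hx]
      rfl
  have hl : ∫⁻ x, ENNReal.ofReal (ProbabilityTheory.betaPDFReal p q x) = 1 :=
    ProbabilityTheory.lintegral_betaPDF_eq_one hp hq
  have hm := (ProbabilityTheory.stronglyMeasurable_betaPDFReal p q).aestronglyMeasurable
    (μ := volume)
  have hint : Integrable (ProbabilityTheory.betaPDFReal p q) := by
    rw [← lintegral_ofReal_ne_top_iff_integrable hm (ae_of_all _ hnonneg), hl]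
    simp
  have hval : ∫ x, ProbabilityTheory.betaPDFReal p q x = 1 := by
    rw [integral_eq_lintegral_of_nonneg_ae (ae_of_all _ hnonneg) hm, hl, ENNReal.toReal_one]
  rw [hfun, integrable_indicator_iff measurableSet_Ioo] at hint
  rw [hfun, integral_indicator measurableSet_Ioo, integral_const_mul] at hval
  refine ⟨?_, ?_⟩
  · rwa [IntegrableOn, integrable_const_mul_iff (by simpa using hB.ne')] at hint
  · change _ = ProbabilityTheory.beta p q
    field_simp at hval
    exact hval

theorem hasMoment_jacobiWeight {a b : ℝ} (ha : -2 < a) (hb : -2 < b) (n : ℕ) :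
    HasMoment (jacobiWeight a b) n (Gamma ((n : ℝ) + a + 2) * Gamma (b + 2) /
      Gamma ((n : ℝ) + a + b + 4)) := by
  have hs : 0 < (n : ℝ) + a + 2 := by have : (0 : ℝ) ≤ n := Nat.cast_nonneg n; linarith
  have hfun : (fun x : ℝ => x ^ n * jacobiWeight a b x) =
      (Ioo 0 1).indicator fun x => x ^ ((n : ℝ) + a + 2 - 1) * (1 - x) ^ (b + 2 - 1) := by
    ext x
    by_cases hx : x ∈ Ioo (0 : ℝ) 1
    · rw [jacobiWeight, indicator_of_mem hx, indicator_of_mem hx, ← mul_assoc, ← rpow_natCast,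
        ← rpow_add hx.1]
      ring_nf
    · rw [jacobiWeight, indicator_of_notMem hx, indicator_of_notMem hx, mul_zero]
  obtain ⟨h1, h2⟩ := integrableOn_and_integral_beta hs (q := b + 2) (by linarith)
  refine ⟨?_, ?_⟩
  · rwa [hfun, integrable_indicator_iff measurableSet_Ioo]
  · rw [moment, hfun, integral_indicator measurableSet_Ioo, h2]
    ring_nf

theorem hasMoment_of_even {w : ℝ → ℝ} (hw : ∀ x, w (-x) = w x) {n : ℕ} {m : ℝ}
    (hi : IntegrableOn (fun x : ℝ => x ^ n * w x) (Ioi 0))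
    (hm : ∫ x in Ioi (0 : ℝ), x ^ n * w x = m / 2) :
    HasMoment w n ((1 + (-1 : ℝ) ^ n) / 2 * m) := by
  have hneg (x : ℝ) : (-x) ^ n * w (-x) = (-1) ^ n * (x ^ n * w x) := by
    rw [hw, neg_pow]
    ring
  have hi' : IntegrableOn (fun x : ℝ => x ^ n * w x) (Iic 0) := by
    rw [← Measure.map_neg_eq_self (volume : Measure ℝ)]
    let e : MeasurableEmbedding fun x : ℝ => -x := (Homeomorph.neg ℝ).measurableEmbedding
    rw [e.integrableOn_map_iff]
    simp only [Function.comp_def, hneg, neg_preimage, neg_Iic, neg_zero]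
    exact Integrable.const_mul ((integrableOn_Ici_iff_integrableOn_Ioi enorm_ne_top).2 hi) _
  have hm' : ∫ x in Iic (0 : ℝ), x ^ n * w x = (-1) ^ n * (m / 2) := by
    rw [← neg_zero, ← integral_comp_neg_Ioi 0 fun x : ℝ => x ^ n * w x]
    simp only [hneg]
    rw [integral_const_mul, hm]
  refine ⟨?_, ?_⟩
  · rw [← integrableOn_univ, ← Iic_union_Ioi (a := (0 : ℝ))]
    exact hi'.union hi
  · rw [moment, ← intervalIntegral.integral_Iic_add_Ioi hi' hi, hm, hm']
    ring

/-- Reflection invariance needs no integrability, so the zero pattern holds also at orders where the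
Cauchy moment diverges and the integral is `0` by convention. -/
theorem moment_odd_of_even {w : ℝ → ℝ} (hw : ∀ x, w (-x) = w x) {n : ℕ} (hn : Odd n) :
    moment w n = 0 := by
  have h := integral_neg_eq_self (fun x : ℝ => x ^ n * w x) volume
  simp only [hw, hn.neg_pow, neg_mul, integral_neg] at h
  rw [moment]
  linarith

theorem hasMoment_hermiteWeight (n : ℕ) : HasMoment hermiteWeight n
    ((1 + (-1 : ℝ) ^ n) / 2 * Gamma (((n : ℝ) + 1) / 2)) := by
  have hn : (-1 : ℝ) < n := by have : (0 : ℝ) ≤ n := Nat.cast_nonneg n; linarith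
  have hfun : (fun x : ℝ => x ^ n * hermiteWeight x) =
      fun x : ℝ => x ^ (n : ℝ) * Real.exp (-x ^ (2 : ℝ)) := by
    ext x
    rw [hermiteWeight, rpow_natCast, rpow_ofNat]
  refine hasMoment_of_even (fun x => by simp [hermiteWeight]) ?_ ?_
  · rw [hfun]
    exact integrableOn_rpow_mul_exp_neg_rpow hn two_pos
  · rw [hfun, integral_rpow_mul_exp_neg_rpow two_pos hn]
    ring

theorem image_sq_div_one_add_sq : (fun x : ℝ => x ^ 2 / (1 + x ^ 2)) '' Ioi 0 = Ioo 0 1 := by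
  ext u
  constructor
  · rintro ⟨x, hx, rfl⟩
    have hx : 0 < x := hx
    exact ⟨by positivity, by rw [div_lt_one (by positivity)]; linarith⟩
  · rintro ⟨h0, h1⟩
    have h1' : 0 < 1 - u := by linarith
    refine ⟨√(u / (1 - u)), Real.sqrt_pos.2 (by positivity), ?_⟩
    simp only
    rw [sq_sqrt (by positivity)]
    field_simp
    ring

theorem injOn_sq_div_one_add_sq : InjOn (fun x : ℝ => x ^ 2 / (1 + x ^ 2)) (Ioi 0) := by
  intro x hx y hy h
  have hx : 0 < x := hx
  have hy : 0 < y := hy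
  simp only at h
  rw [div_eq_div_iff (by positivity) (by positivity)] at h
  exact (pow_left_inj₀ hx.le hy.le two_ne_zero).1 (by linarith)

/-- On the half-line, `u = x² / (1 + x²)` gives `1 - u = 1 / (1 + x²)` and turns the moment into
half a beta integral; `n < 2a - 3` is positivity of its second parameter. -/
theorem hasMoment_cauchyWeight {a : ℝ} {n : ℕ} (hn : (n : ℝ) < 2 * a - 3) :
    HasMoment (cauchyWeight a) n ((1 + (-1 : ℝ) ^ n) / 2 *
      (Gamma (((n : ℝ) + 1) / 2) * Gamma (a - 1 - ((n : ℝ) + 1) / 2) / Gamma (a - 1))) := by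
  have hderiv (x : ℝ) (_ : x ∈ Ioi (0 : ℝ)) : HasDerivWithinAt
      (fun x : ℝ => x ^ 2 / (1 + x ^ 2)) (2 * x / (1 + x ^ 2) ^ 2) (Ioi 0) x := by
    have h := ((hasDerivAt_pow 2 x).div ((hasDerivAt_pow 2 x).const_add 1)
      (by positivity : (1 + x ^ 2 : ℝ) ≠ 0)).hasDerivWithinAt (s := Ioi 0)
    refine h.congr_deriv ?_
    push_cast
    field_simp
    ring
  obtain ⟨h1, h2⟩ := integrableOn_and_integral_beta (p := ((n : ℝ) + 1) / 2)
    (q := a - 1 - ((n : ℝ) + 1) / 2) (by positivity) (by linarith)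
  rw [← image_sq_div_one_add_sq,
    integrableOn_image_iff_integrableOn_abs_deriv_smul measurableSet_Ioi hderiv
      injOn_sq_div_one_add_sq] at h1
  rw [← image_sq_div_one_add_sq, integral_image_eq_integral_abs_deriv_smul measurableSet_Ioi hderiv
      injOn_sq_div_one_add_sq] at h2
  have hfun : EqOn (fun x : ℝ => |2 * x / (1 + x ^ 2) ^ 2| •
      ((x ^ 2 / (1 + x ^ 2)) ^ (((n : ℝ) + 1) / 2 - 1) *
        (1 - x ^ 2 / (1 + x ^ 2)) ^ (a - 1 - ((n : ℝ) + 1) / 2 - 1)))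
      (fun x => 2 * (x ^ n * cauchyWeight a x)) (Ioi 0) := by
    intro x hx
    have hx : 0 < x := hx
    have hy : 0 < 1 + x ^ 2 := by positivity
    have e1 : 1 - x ^ 2 / (1 + x ^ 2) = (1 + x ^ 2)⁻¹ := by
      field_simp
      ring
    have e2 : (x ^ 2 : ℝ) ^ (((n : ℝ) + 1) / 2 - 1) * x = x ^ n := by
      rw [← rpow_natCast x 2, ← rpow_mul hx.le, ← rpow_add_one hx.ne', ← rpow_natCast]
      push_cast
      ring_nf
    simp only [smul_eq_mul, cauchyWeight]
    rw [abs_of_pos (by positivity), e1, div_rpow (by positivity) hy.le, inv_rpow hy.le,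
      ← rpow_neg hy.le, div_eq_mul_inv _ ((1 + x ^ 2) ^ (((n : ℝ) + 1) / 2 - 1)),
      ← rpow_neg hy.le, ← e2]
    rw [← rpow_natCast (1 + x ^ 2) 2, div_eq_mul_inv, ← rpow_neg hy.le]
    have e3 : (1 + x ^ 2) ^ (-((2 : ℕ) : ℝ)) * (1 + x ^ 2) ^ (-(((n : ℝ) + 1) / 2 - 1)) *
        (1 + x ^ 2) ^ (-(a - 1 - ((n : ℝ) + 1) / 2 - 1)) = (1 + x ^ 2) ^ (1 - a) := by
      rw [← rpow_add hy, ← rpow_add hy]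
      congr 1
      push_cast
      ring
    rw [← e3]
    ring
  refine hasMoment_of_even (fun x => by simp [cauchyWeight]) ?_ ?_
  · have h := (integrableOn_congr_fun hfun measurableSet_Ioi).1 h1
    rwa [IntegrableOn, integrable_const_mul_iff (by simp)] at h
  · rw [setIntegral_congr_fun measurableSet_Ioi hfun, integral_const_mul] at h2
    rw [show ((n : ℝ) + 1) / 2 + (a - 1 - ((n : ℝ) + 1) / 2) = a - 1 by ring] at h2
    linarith

end Moments

/-! ### Closed forms of the pivot products and the four evaluations. -/

section Evaluation

open Finset

theorem Gamma_half_factor (K : ℕ) : 2 * (K ! : ℝ) * Gamma ((K : ℝ) + 3 / 2) =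
    (2 : ℝ) ^ (-(2 * K : ℤ)) * √π * Gamma (2 * (K : ℝ) + 2) := by
  have h := Gamma_mul_Gamma_add_half ((K : ℝ) + 1)
  rw [Gamma_nat_eq_factorial, show (K : ℝ) + 1 + 1 / 2 = K + 3 / 2 by ring,
    show 2 * ((K : ℝ) + 1) = 2 * K + 2 by ring] at h
  have h2 : (2 : ℝ) * 2 ^ (1 - (2 * (K : ℝ) + 2)) = 2 ^ (-(2 * K : ℤ)) := by
    nth_rewrite 1 [← rpow_one (2 : ℝ)]
    rw [← rpow_intCast, ← rpow_add two_pos]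
    push_cast
    ring_nf
  rw [mul_assoc, h, ← h2]
  ring

theorem prod_hermite (N : ℕ) :
    ∏ K ∈ range N, 2 * (K ! : ℝ) * Gamma ((K : ℝ) + 3 / 2) =
      (2 : ℝ) ^ (-((N : ℤ) * ((N : ℤ) - 1))) * √π ^ N *
        ∏ i ∈ range N, Gamma (2 * (i : ℝ) + 2) := by
  induction N with
  | zero => simp
  | succ N ih =>
    have h : (2 : ℝ) ^ (-(((N + 1 : ℕ) : ℤ) * (((N + 1 : ℕ) : ℤ) - 1))) =
        2 ^ (-((N : ℤ) * ((N : ℤ) - 1))) * 2 ^ (-(2 * N : ℤ)) := by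
      rw [← zpow_add₀ two_ne_zero]
      congr 1
      push_cast
      ring
    rw [prod_range_succ, prod_range_succ, ih, Gamma_half_factor, h]
    ring

theorem prod_jacobi (N : ℕ) (s : ℝ) (hs : -4 < s) (hs2 : s ≠ -2) :
    ∏ i ∈ range N, (s + 4 * i + 2) =
      (4 : ℝ) ^ N * (Gamma ((N : ℝ) + (s + 2) / 4) / Gamma ((s + 2) / 4)) := by
  have hne (i : ℕ) : (s + 2) / 4 + (i : ℝ) ≠ 0 := by
    rcases Nat.eq_zero_or_pos i with rfl | hi
    · intro h
      exact hs2 (by push_cast at h; linarith)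
    · have : (1 : ℝ) ≤ i := by exact_mod_cast hi
      intro h
      linarith
  induction N with
  | zero =>
    have : Gamma ((s + 2) / 4) ≠ 0 := Gamma_ne_zero fun i h => hne i (by rw [h]; ring)
    simp [this]
  | succ N ih =>
    rw [prod_range_succ, ih, show ((N + 1 : ℕ) : ℝ) + (s + 2) / 4 = (s + 2) / 4 + N + 1 by
      push_cast; ring, Gamma_add_one (hne N), add_comm (N : ℝ)]
    ring

/-- Legendre duplication at `K + 1`, `a - K - 1/2`, `a - 2K - 1` and `a - 2K - 3/2`. The last two
each bring in a factor `Γ(a - 2K - 1)`, whence its square in the denominator. -/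
theorem cauchy_factor {a : ℝ} (K : ℕ) (ha : 2 * (K : ℝ) + 3 / 2 < a) :
    2 * (K ! : ℝ) * Gamma ((K : ℝ) + 3 / 2) * (a - 2 * K - 1) *
      Gamma (a - 2 * K - 1 / 2) * Gamma (a - 2 * K - 3 / 2) /
        (Gamma (a - K) * Gamma (a - K - 1 / 2)) =
    π * (2 : ℝ) ^ (6 + 4 * (K : ℝ) - 2 * a) * ((a + 1) / 2 - K - 1) *
      ((Gamma (2 * (K : ℝ) + 2) * Gamma (2 * a - 4 * (K : ℝ) - 2) *
        Gamma (2 * a - 4 * (K : ℝ) - 3)) /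
          (Gamma (2 * a - 2 * (K : ℝ) - 1) * Gamma (a - 2 * (K : ℝ) - 1) ^ 2)) := by
  have hK : (0 : ℝ) ≤ K := Nat.cast_nonneg K
  have d1 := Gamma_mul_Gamma_add_half ((K : ℝ) + 1)
  have d2 := Gamma_mul_Gamma_add_half (a - K - 1 / 2)
  have d3 := Gamma_mul_Gamma_add_half (a - 2 * K - 1)
  have d4 := Gamma_mul_Gamma_add_half (a - 2 * K - 3 / 2)
  rw [Gamma_nat_eq_factorial, show (K : ℝ) + 1 + 1 / 2 = K + 3 / 2 by ring,
    show 2 * ((K : ℝ) + 1) = 2 * K + 2 by ring] at d1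
  rw [show a - (K : ℝ) - 1 / 2 + 1 / 2 = a - K by ring,
    show 2 * (a - (K : ℝ) - 1 / 2) = 2 * a - 2 * K - 1 by ring] at d2
  rw [show a - 2 * (K : ℝ) - 1 + 1 / 2 = a - 2 * K - 1 / 2 by ring,
    show 2 * (a - 2 * (K : ℝ) - 1) = 2 * a - 4 * K - 2 by ring] at d3
  rw [show a - 2 * (K : ℝ) - 3 / 2 + 1 / 2 = a - 2 * K - 1 by ring,
    show 2 * (a - 2 * (K : ℝ) - 3 / 2) = 2 * a - 4 * K - 3 by ring] at d4
  have hpow : (4 : ℝ) * 2 ^ (1 - (2 * (K : ℝ) + 2)) * 2 ^ (1 - (2 * a - 4 * (K : ℝ) - 2)) *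
      2 ^ (1 - (2 * a - 4 * (K : ℝ) - 3)) =
      2 ^ (6 + 4 * (K : ℝ) - 2 * a) * 2 ^ (1 - (2 * a - 2 * (K : ℝ) - 1)) := by
    rw [show (4 : ℝ) = 2 ^ (2 : ℝ) by norm_num]
    simp only [← rpow_add two_pos]
    ring_nf
  have p1 : Gamma (a - K) ≠ 0 := (Gamma_pos_of_pos (by linarith)).ne'
  have p2 : Gamma (a - K - 1 / 2) ≠ 0 := (Gamma_pos_of_pos (by linarith)).ne'
  have p3 : Gamma (a - 2 * K - 1) ≠ 0 := (Gamma_pos_of_pos (by linarith)).ne'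
  have p4 : Gamma (2 * a - 2 * K - 1) ≠ 0 := (Gamma_pos_of_pos (by linarith)).ne'
  have hpi : √π * √π = π := mul_self_sqrt pi_pos.le
  rw [mul_div_assoc', div_eq_div_iff (mul_ne_zero p1 p2) (mul_ne_zero p4 (pow_ne_zero 2 p3))]
  generalize Gamma (2 * (K : ℝ) + 2) = g1 at *
  generalize Gamma (2 * a - 2 * (K : ℝ) - 1) = g2 at *
  generalize Gamma (2 * a - 4 * (K : ℝ) - 2) = g3 at *
  generalize Gamma (2 * a - 4 * (K : ℝ) - 3) = g4 at *
  generalize (2 : ℝ) ^ (1 - (2 * (K : ℝ) + 2)) = u1 at *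
  generalize (2 : ℝ) ^ (1 - (2 * a - 4 * (K : ℝ) - 2)) = u3 at *
  generalize (2 : ℝ) ^ (1 - (2 * a - 4 * (K : ℝ) - 3)) = u4 at *
  generalize (2 : ℝ) ^ (1 - (2 * a - 2 * (K : ℝ) - 1)) = u2 at *
  generalize (2 : ℝ) ^ (6 + 4 * (K : ℝ) - 2 * a) = v at *
  calc _ = 2 * (a - 2 * K - 1) * g2 * ((K ! : ℝ) * Gamma ((K : ℝ) + 3 / 2)) *
        (Gamma (a - 2 * K - 1) * Gamma (a - 2 * K - 1 / 2)) *
        (Gamma (a - 2 * K - 3 / 2) * Gamma (a - 2 * K - 1)) := by ring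
    _ = (a - 2 * K - 1) * g1 * g2 * g3 * g4 * (4 * u1 * u3 * u4) / 2 * (√π * √π) * √π := by
        rw [d1, d3, d4]
        ring
    _ = π * v * ((a + 1) / 2 - K - 1) * (g1 * g3 * g4) * (g2 * u2 * √π) := by
        rw [hpow, hpi]
        ring
    _ = _ := by
        rw [← d2]
        ring

theorem prod_cauchy (N : ℕ) (a : ℝ) (ha : 2 * (N : ℝ) - 1 / 2 < a) :
    ∏ K ∈ range N, 2 * (K ! : ℝ) * Gamma ((K : ℝ) + 3 / 2) * (a - 2 * K - 1) *
      Gamma (a - 2 * K - 1 / 2) * Gamma (a - 2 * K - 3 / 2) /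
        (Gamma (a - K) * Gamma (a - K - 1 / 2)) =
    π ^ N * (2 : ℝ) ^ (2 * (N : ℝ) ^ 2 - (N : ℝ) * (2 * a - 4)) *
      (Gamma ((a + 1) / 2) / Gamma ((a + 1) / 2 - (N : ℝ))) *
      ∏ i ∈ range N, (Gamma (2 * (i : ℝ) + 2) * Gamma (2 * a - 4 * (i : ℝ) - 2) *
        Gamma (2 * a - 4 * (i : ℝ) - 3)) /
          (Gamma (2 * a - 2 * (i : ℝ) - 1) * Gamma (a - 2 * (i : ℝ) - 1) ^ 2) := by
  induction N with
  | zero =>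
    have : Gamma ((a + 1) / 2) ≠ 0 := (Gamma_pos_of_pos (by push_cast at ha; linarith)).ne'
    simp [this]
  | succ N ih =>
    push_cast at ha
    have hx : 0 < (a + 1) / 2 - N - 1 := by linarith
    have h : (2 : ℝ) ^ (2 * ((N + 1 : ℕ) : ℝ) ^ 2 - ((N + 1 : ℕ) : ℝ) * (2 * a - 4)) =
        2 ^ (2 * (N : ℝ) ^ 2 - (N : ℝ) * (2 * a - 4)) * 2 ^ (6 + 4 * (N : ℝ) - 2 * a) := by
      rw [← rpow_add two_pos]
      congr 1
      push_cast
      ring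
    have hG := Gamma_add_one hx.ne'
    rw [show (a + 1) / 2 - (N : ℝ) - 1 + 1 = (a + 1) / 2 - N by ring] at hG
    have hG0 := (Gamma_pos_of_pos hx).ne'
    have hG1 : Gamma ((a + 1) / 2) / Gamma ((a + 1) / 2 - ((N + 1 : ℕ) : ℝ)) =
        Gamma ((a + 1) / 2) / Gamma ((a + 1) / 2 - N) * ((a + 1) / 2 - N - 1) := by
      rw [hG, show (a + 1) / 2 - ((N + 1 : ℕ) : ℝ) = (a + 1) / 2 - N - 1 by push_cast; ring]
      generalize (a + 1) / 2 - (N : ℝ) - 1 = x at hx hG0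
      have := hx.ne'
      field_simp
    rw [prod_range_succ, prod_range_succ, ih (by linarith), cauchy_factor N (by linarith), h, hG1]
    ring

theorem catalanHankelPf_eq (μ : ℕ → ℝ) (N : ℕ) : catalanHankelPf μ N =
    pfaffian N (Matrix.of fun i j : Fin (2 * N) =>
      (fun i j : ℕ => ((j : ℝ) - i) * μ (i + j - 1)) i j) := rfl

theorem catalanHankel_entry_skew (μ : ℕ → ℝ) (i j : ℕ) :
    ((i : ℝ) - j) * μ (j + i - 1) = -(((j : ℝ) - i) * μ (i + j - 1)) := by
  rw [add_comm j]
  ring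

theorem catalanHankelPf_hermite (N : ℕ) : catalanHankelPf (moment hermiteWeight) N =
    (2 : ℝ) ^ (-((N : ℤ) * ((N : ℤ) - 1))) * √π ^ N *
      ∏ i ∈ range N, Gamma (2 * (i : ℝ) + 2) := by
  rw [catalanHankelPf_eq, ← prod_hermite]
  refine pfaffian_of_Gamma_half N (fun i j : ℕ => ((j : ℝ) - i) * moment hermiteWeight (i + j - 1))
    (catalanHankel_entry_skew _) (fun I J => ?_) (fun I J => ?_)
  · rw [moment_odd_of_even (fun x => by simp [hermiteWeight]) ⟨I + J, by omega⟩, mul_zero]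
  · rw [show 2 * I + 1 + 2 * J - 1 = 2 * (I + J) by omega, (hasMoment_hermiteWeight _).2,
      Even.neg_one_pow (even_two_mul _)]
    push_cast
    rw [show (2 * ((I : ℝ) + J) + 1) / 2 = I + J + 1 / 2 by ring]
    ring

theorem catalanHankelPf_laguerre (N : ℕ) {a : ℝ} (ha : -2 < a) :
    catalanHankelPf (moment (laguerreWeight a)) N =
      ∏ i ∈ range N, Gamma (2 * (i : ℝ) + 2) * Gamma (2 * (i : ℝ) + a + 2) := by
  rw [catalanHankelPf_eq, pfaffian_of_Gamma N (a + 1) (by linarith)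
    (fun i j : ℕ => ((j : ℝ) - i) * moment (laguerreWeight a) (i + j - 1))]
  · refine prod_congr rfl fun i _ => ?_
    ring_nf
  · intro i j hij
    rw [(hasMoment_laguerreWeight ha _).2, Nat.cast_sub (by omega)]
    push_cast
    ring_nf
  · simp

theorem catalanHankelPf_jacobi (N : ℕ) {a b : ℝ} (ha : -2 < a) (hb : -2 < b) (h2 : a + b ≠ -2)
    (h3 : a + b ≠ -3) : catalanHankelPf (moment (jacobiWeight a b)) N =
      (4 : ℝ) ^ N * (Gamma ((N : ℝ) + (a + b + 2) / 4) / Gamma ((a + b + 2) / 4)) *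
        ∏ i ∈ range N, (Gamma (a + 2 * (i : ℝ) + 2) * Gamma (b + 2 * (i : ℝ) + 2) *
          Gamma (2 * (i : ℝ) + 2) * Gamma (a + b + 2 * (i : ℝ) + 2)) /
            (Gamma (a + b + 4 * (i : ℝ) + 3) * Gamma (a + b + 4 * (i : ℝ) + 4)) := by
  rw [catalanHankelPf_eq, ← prod_jacobi N (a + b) (by linarith) h2, ← prod_mul_distrib]
  refine pfaffian_of_beta N a b ha hb h2 h3
    (fun i j : ℕ => ((j : ℝ) - i) * moment (jacobiWeight a b) (i + j - 1)) (fun i j hij => ?_) ?_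
  · rw [(hasMoment_jacobiWeight ha hb _).2, Nat.cast_sub (by omega)]
    push_cast
    ring_nf
  · simp

theorem catalanHankelPf_cauchy (N : ℕ) {a : ℝ} (ha : 2 * (N : ℝ) - 1 / 2 < a) :
    catalanHankelPf (moment (cauchyWeight a)) N =
      π ^ N * (2 : ℝ) ^ (2 * (N : ℝ) ^ 2 - (N : ℝ) * (2 * a - 4)) *
        (Gamma ((a + 1) / 2) / Gamma ((a + 1) / 2 - (N : ℝ))) *
        ∏ i ∈ range N, (Gamma (2 * (i : ℝ) + 2) * Gamma (2 * a - 4 * (i : ℝ) - 2) *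
          Gamma (2 * a - 4 * (i : ℝ) - 3)) /
            (Gamma (2 * a - 2 * (i : ℝ) - 1) * Gamma (a - 2 * (i : ℝ) - 1) ^ 2) := by
  rw [catalanHankelPf_eq, ← prod_cauchy N a ha]
  refine pfaffian_of_Gamma_mul_Gamma N a ha
    (fun i j : ℕ => ((j : ℝ) - i) * moment (cauchyWeight a) (i + j - 1))
    (catalanHankel_entry_skew _) (fun I J => ?_) (fun I J hI hJ => ?_)
  · rw [moment_odd_of_even (fun x => by simp [cauchyWeight]) ⟨I + J, by omega⟩, mul_zero]
  · have hI' : (I : ℝ) + 1 ≤ N := by exact_mod_cast hI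
    have hJ' : (J : ℝ) + 1 ≤ N := by exact_mod_cast hJ
    -- The order `2 (I + J)` is at most `4N - 4`, which is below `2a - 3` by the hypothesis on `a`.
    rw [show 2 * I + 1 + 2 * J - 1 = 2 * (I + J) by omega,
      (hasMoment_cauchyWeight (by push_cast; linarith)).2, Even.neg_one_pow (even_two_mul _)]
    push_cast
    rw [show (2 * ((I : ℝ) + J) + 1) / 2 = I + J + 1 / 2 by ring,
      show a - 1 - ((I : ℝ) + J + 1 / 2) = a - 3 / 2 - I - J by ring]
    ring

end Evaluation

end CatalanHankel

theorem mainTheorem1 (N : ℕ) :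
    -- Hermite
    ((∀ n : ℕ, CatalanHankel.HasMoment CatalanHankel.hermiteWeight n
        ((1 + (-1 : ℝ) ^ n) / 2 * Real.Gamma (((n : ℝ) + 1) / 2))) ∧
      CatalanHankel.catalanHankelPf (CatalanHankel.moment CatalanHankel.hermiteWeight) N =
        (2 : ℝ) ^ (-((N : ℤ) * ((N : ℤ) - 1))) * √Real.pi ^ N *
          ∏ i ∈ Finset.range N, Real.Gamma (2 * (i : ℝ) + 2)) ∧
    -- Laguerre
    (∀ a : ℝ, -2 < a →
      (∀ n : ℕ, CatalanHankel.HasMoment (CatalanHankel.laguerreWeight a) n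
        (Real.Gamma ((n : ℝ) + a + 2))) ∧
      CatalanHankel.catalanHankelPf (CatalanHankel.moment (CatalanHankel.laguerreWeight a)) N =
        ∏ i ∈ Finset.range N,
          Real.Gamma (2 * (i : ℝ) + 2) * Real.Gamma (2 * (i : ℝ) + a + 2)) ∧
    -- the Mehta–Wang form of the Laguerre case
    (∀ b : ℝ, -1 < b →
      CatalanHankel.pfaffian N (Matrix.of fun i j =>
          (((j : ℕ) : ℝ) - ((i : ℕ) : ℝ)) *
            Real.Gamma (((i : ℕ) : ℝ) + ((j : ℕ) : ℝ) + b)) =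
        ∏ i ∈ Finset.range N,
          Real.Gamma (2 * (i : ℝ) + 2) * Real.Gamma (2 * (i : ℝ) + b + 1)) ∧
    -- Jacobi
    (∀ a b : ℝ, -2 < a → -2 < b →
      (∀ n : ℕ, CatalanHankel.HasMoment (CatalanHankel.jacobiWeight a b) n
        (Real.Gamma ((n : ℝ) + a + 2) * Real.Gamma (b + 2) /
          Real.Gamma ((n : ℝ) + a + b + 4))) ∧
      (a + b ≠ -2 → a + b ≠ -3 →
        CatalanHankel.catalanHankelPf (CatalanHankel.moment (CatalanHankel.jacobiWeight a b)) N =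
          (4 : ℝ) ^ N *
            (Real.Gamma ((N : ℝ) + (a + b + 2) / 4) / Real.Gamma ((a + b + 2) / 4)) *
            ∏ i ∈ Finset.range N,
              (Real.Gamma (a + 2 * (i : ℝ) + 2) * Real.Gamma (b + 2 * (i : ℝ) + 2) *
                  Real.Gamma (2 * (i : ℝ) + 2) * Real.Gamma (a + b + 2 * (i : ℝ) + 2)) /
                (Real.Gamma (a + b + 4 * (i : ℝ) + 3) *
                  Real.Gamma (a + b + 4 * (i : ℝ) + 4)))) ∧
    -- Cauchy; the hypothesis on `a` says exactly that the moment of order `4N - 4` (the highest one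
    -- that occurs in the Pfaffian, when `N ≥ 1`) converges
    (∀ a : ℝ, 2 * (N : ℝ) - 1 / 2 < a →
      (∀ n : ℕ, (n : ℝ) < 2 * a - 3 →
        CatalanHankel.HasMoment (CatalanHankel.cauchyWeight a) n
          ((1 + (-1 : ℝ) ^ n) / 2 *
            (Real.Gamma (((n : ℝ) + 1) / 2) * Real.Gamma (a - 1 - ((n : ℝ) + 1) / 2) /
              Real.Gamma (a - 1)))) ∧
      CatalanHankel.catalanHankelPf (CatalanHankel.moment (CatalanHankel.cauchyWeight a)) N =
        Real.pi ^ N * (2 : ℝ) ^ (2 * (N : ℝ) ^ 2 - (N : ℝ) * (2 * a - 4)) *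
          (Real.Gamma ((a + 1) / 2) / Real.Gamma ((a + 1) / 2 - (N : ℝ))) *
          ∏ i ∈ Finset.range N,
            (Real.Gamma (2 * (i : ℝ) + 2) * Real.Gamma (2 * a - 4 * (i : ℝ) - 2) *
                Real.Gamma (2 * a - 4 * (i : ℝ) - 3)) /
              (Real.Gamma (2 * a - 2 * (i : ℝ) - 1) * Real.Gamma (a - 2 * (i : ℝ) - 1) ^ 2)) := by
  refine ⟨⟨CatalanHankel.hasMoment_hermiteWeight, CatalanHankel.catalanHankelPf_hermite N⟩,
    fun a ha => ⟨CatalanHankel.hasMoment_laguerreWeight ha,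
      CatalanHankel.catalanHankelPf_laguerre N ha⟩,
    fun b hb => CatalanHankel.pfaffian_of_Gamma N b hb
      (fun i j : ℕ => ((j : ℝ) - i) * Real.Gamma ((i : ℝ) + j + b)) (fun _ _ _ => rfl) (by simp),
    fun a b ha hb => ⟨CatalanHankel.hasMoment_jacobiWeight ha hb,
      CatalanHankel.catalanHankelPf_jacobi N ha hb⟩,
    fun a ha => ⟨fun n hn => CatalanHankel.hasMoment_cauchyWeight hn,
      CatalanHankel.catalanHankelPf_cauchy N ha⟩⟩
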